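/- An approval election consists of a finite set $C$ of candidates and voters $v_1,\dots,v_n$, each of whom approves a subset of $C$ (his or her ballot). The score of a candidate is the number of voters approving it, and the score of a committee $S\subseteq C$ is the sum of the scores of its members; the winning committees of size $k$ are the size-$k$ subsets of $C$ with the highest score. The election has the voter interval (VI) property, with respect to the order $v_1,\dots,v_n$, if for each candidate the voters approving it form a (possibly empty) interval of this order. Consider the following decision problem. An instance consists of an approval election that has the VI property with respect to its given order of the voters, a committee size $k$ with $1\le k\le |C|$, a preferred candidate $p\in C$, a price in $\{0,1,2,\dots\}\cup\{+\infty\}$ for each pair of a voter $v$ and a candidate $c$, and a budget $B\in\{0,1,2,\dots\}$; all numbers are written in binary. A unit operation chooses a voter $v$ and a candidate $c$ such that $v$ currently approves $c$ but not $p$, replaces $c$ by $p$ in the ballot of $v$, and costs the price of $(v,c)$. The question is whether there is a sequence of unit operations of total cost at most $B$ such that the resulting election has the VI property with respect to the same order of the voters, and $p$ belongs to at least one winning committee of size $k$. **Theorem.** This problem is solvable in polynomial time, i.e., it belongs to $\mathrm{P}$. -/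

import Mathlib

namespace ApprovalBribery

/-! ### Random access machines with logarithmic cost, and the class P -/

/-- A state of a random access machine: registers and a random access memory,
both holding natural numbers. -/
structure RAMState where
  reg : ℕ → ℕ
  mem : ℕ → ℕ

/-- Programs of a random access machine with structured control flow. A program names finitely
many registers; the memory is addressed indirectly through registers. -/
inductive RAMProg : Type
  /-- do nothing -/
  | skip : RAMProg
  /-- `r := a` -/
  | const (r a : ℕ) : RAMProg
  /-- `r := s + t` -/
  | add (r s t : ℕ) : RAMProg
  /-- `r := max (s - t) 0` -/
  | sub (r s t : ℕ) : RAMProg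
  /-- `r := mem[s]` -/
  | load (r s : ℕ) : RAMProg
  /-- `mem[r] := s` -/
  | store (r s : ℕ) : RAMProg
  /-- sequential composition -/
  | seq (P Q : RAMProg) : RAMProg
  /-- `if r ≠ 0 then P else Q` -/
  | ite (r : ℕ) (P Q : RAMProg) : RAMProg
  /-- `while r ≠ 0 do P` -/
  | while (r : ℕ) (P : RAMProg) : RAMProg

namespace RAMState

/-- Write the value `a` into register `r`. -/
def setReg (s : RAMState) (r a : ℕ) : RAMState :=
  { s with reg := Function.update s.reg r a }

/-- Write the value `a` into the memory cell with address `i`. -/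
def setMem (s : RAMState) (i a : ℕ) : RAMState :=
  { s with mem := Function.update s.mem i a }

/-- The initial state on input `x`: the memory holds the entries of `x`, register `0` holds the
number of entries, and everything else is `0`. -/
def init (x : List ℕ) : RAMState where
  reg := Function.update (fun _ => 0) 0 x.length
  mem := fun i => x.getD i 0

end RAMState

/-- `RAMExec P s s' t`: started in state `s`, the program `P` halts in state `s'` after total time
`t`. Time is logarithmic cost: each executed instruction or test costs `1` plus the number of
binary digits of the numbers and memory addresses on which it operates. -/
inductive RAMExec : RAMProg → RAMState → RAMState → ℕ → Prop
  | skip (s : RAMState) : RAMExec .skip s s 1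
  | const (s : RAMState) (r a : ℕ) :
      RAMExec (.const r a) s (s.setReg r a) (1 + Nat.size a)
  | add (s : RAMState) (r i j : ℕ) :
      RAMExec (.add r i j) s (s.setReg r (s.reg i + s.reg j))
        (1 + Nat.size (s.reg i) + Nat.size (s.reg j))
  | sub (s : RAMState) (r i j : ℕ) :
      RAMExec (.sub r i j) s (s.setReg r (s.reg i - s.reg j))
        (1 + Nat.size (s.reg i) + Nat.size (s.reg j))
  | load (s : RAMState) (r i : ℕ) :
      RAMExec (.load r i) s (s.setReg r (s.mem (s.reg i)))
        (1 + Nat.size (s.reg i) + Nat.size (s.mem (s.reg i)))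
  | store (s : RAMState) (r i : ℕ) :
      RAMExec (.store r i) s (s.setMem (s.reg r) (s.reg i))
        (1 + Nat.size (s.reg r) + Nat.size (s.reg i))
  | seq {P Q : RAMProg} {s s' s'' : RAMState} {t t' : ℕ} :
      RAMExec P s s' t → RAMExec Q s' s'' t' → RAMExec (.seq P Q) s s'' (t + t')
  | ite_true {r : ℕ} {P Q : RAMProg} {s s' : RAMState} {t : ℕ} :
      s.reg r ≠ 0 → RAMExec P s s' t →
      RAMExec (.ite r P Q) s s' (1 + Nat.size (s.reg r) + t)
  | ite_false {r : ℕ} {P Q : RAMProg} {s s' : RAMState} {t : ℕ} :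
      s.reg r = 0 → RAMExec Q s s' t →
      RAMExec (.ite r P Q) s s' (1 + Nat.size (s.reg r) + t)
  | while_true {r : ℕ} {P : RAMProg} {s s' s'' : RAMState} {t t' : ℕ} :
      s.reg r ≠ 0 → RAMExec P s s' t → RAMExec (.while r P) s' s'' t' →
      RAMExec (.while r P) s s'' (1 + Nat.size (s.reg r) + t + t')
  | while_false {r : ℕ} {P : RAMProg} {s : RAMState} :
      s.reg r = 0 → RAMExec (.while r P) s s (1 + Nat.size (s.reg r))

/-- The size of an input: the total length of the binary representations of its entries, plus one
separator per entry. -/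
def inputSize (x : List ℕ) : ℕ := (x.map fun a => Nat.size a + 1).sum

/-- A language (a set of finite sequences of natural numbers, written in binary) is in P if some
random access machine, on every input, halts within time polynomial in the size of the input, with
output (register `0`) equal to `1` exactly if the input belongs to the language. -/
def InP (L : Set (List ℕ)) : Prop :=
  ∃ (P : RAMProg) (q : Polynomial ℕ), ∀ x : List ℕ,
    ∃ (s : RAMState) (t : ℕ), RAMExec P (RAMState.init x) s t ∧
      t ≤ q.eval (inputSize x) ∧ (s.reg 0 = 1 ↔ x ∈ L)

/-! ### Approval elections -/

/-- An approval election with voters `V` and candidates `C`: each voter has an approval ballot. -/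
abbrev Election (V C : Type) := V → Finset C

namespace Election

/-- The approval score of a candidate. -/
def score {V C : Type} [Fintype V] [DecidableEq C] (E : Election V C) (c : C) : ℕ :=
  (Finset.univ.filter fun v => c ∈ E v).card

/-- The approval score of a committee. -/
def committeeScore {V C : Type} [Fintype V] [DecidableEq C] (E : Election V C)
    (S : Finset C) : ℕ :=
  ∑ c ∈ S, E.score c

/-- `S` is a winning committee of size `k` under multiwinner approval voting. -/
def IsWinningCommittee {V C : Type} [Fintype V] [DecidableEq C] (E : Election V C) (k : ℕ)
    (S : Finset C) : Prop :=
  S.card = k ∧ ∀ T : Finset C, T.card = k → E.committeeScore T ≤ E.committeeScore S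

/-- The voter interval property with respect to the given order of the voters: each candidate is
approved by a (possibly empty) interval of voters. -/
def IsVoterInterval {V C : Type} [LinearOrder V] (E : Election V C) : Prop :=
  ∀ c : C, Set.OrdConnected {v : V | c ∈ E v}

/-- The election after moving, in the ballot of `v`, an approval from `c` to `d`. -/
def swap {V C : Type} [DecidableEq V] [DecidableEq C] (E : Election V C) (v : V) (c d : C) :
    Election V C :=
  Function.update E v (insert d ((E v).erase c))

end Election

/-- `BribeToP price p E E' w`: some sequence of unit operations of total cost `w`, each of which
moves an approval to `p` from another candidate in the ballot of some voter, transforms `E` into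
`E'`. Here `price v c` is the price of moving an approval from `c` to `p` in the ballot of `v`;
price `⊤` means that the operation is not available. -/
inductive BribeToP {V C : Type} [DecidableEq V] [DecidableEq C] (price : V → C → ℕ∞) (p : C) :
    Election V C → Election V C → ℕ∞ → Prop
  | refl (E : Election V C) : BribeToP price p E E 0
  | step {E E' : Election V C} {w : ℕ∞} (v : V) (c : C) :
      BribeToP price p E E' w → c ∈ E' v → p ∉ E' v →
      BribeToP price p E (E'.swap v c p) (w + price v c)

/-! ### The computational problem -/

/-- The data of a bribery instance. The voters `0, …, n - 1` are listed in the order that is to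
witness the voter interval property. -/
structure BriberyInstance where
  /-- number of voters -/
  n : ℕ
  /-- number of candidates -/
  m : ℕ
  /-- the approval ballots -/
  election : Election (Fin n) (Fin m)
  /-- the price of moving an approval from a candidate to `p` in the ballot of a voter -/
  price : Fin n → Fin m → ℕ∞
  /-- the committee size -/
  k : ℕ
  one_le_k : 1 ≤ k
  k_le_m : k ≤ m
  /-- the preferred candidate -/
  p : Fin m
  /-- the budget -/
  B : ℕ

/-- The code of a price: `0` for an infinite price, and `w + 1` for a finite price `w`. -/
def encodePrice (w : ℕ∞) : ℕ :=
  match w with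
  | none => 0
  | some a => a + 1

/-- An instance as a sequence of numbers: `n, m, k, p, B`, then the `n × m` approval matrix row by
row (one row for each voter), then the `n × m` price matrix row by row. -/
def BriberyInstance.encode (I : BriberyInstance) : List ℕ :=
  [I.n, I.m, I.k, (I.p : ℕ), I.B]
    ++ List.ofFn (fun i : Fin (I.n * I.m) => if i.modNat ∈ I.election i.divNat then 1 else 0)
    ++ List.ofFn (fun i : Fin (I.n * I.m) => encodePrice (I.price i.divNat i.modNat))

/-- Some bribery of total cost at most `B`, each unit operation of which moves an approval to `p`,
leads to an election that has the voter interval property (for the same order of the voters) and in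
which `p` belongs to at least one winning committee. -/
def BriberyInstance.Solvable (I : BriberyInstance) : Prop :=
  ∃ (E' : Election (Fin I.n) (Fin I.m)) (w : ℕ∞),
    BribeToP I.price I.p I.election E' w ∧ w ≤ (I.B : ℕ∞) ∧ E'.IsVoterInterval ∧
      ∃ S : Finset (Fin I.m), E'.IsWinningCommittee I.k S ∧ I.p ∈ S

/-- Priced approval-swap bribery to the preferred candidate for voter interval elections under
multiwinner approval voting, as a language: the codes of all instances whose election has the voter
interval property (for the given order) and that admit a successful bribery within the budget. -/
def SwapApprovalsToPVIBribery : Set (List ℕ) :=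
  {x | ∃ I : BriberyInstance, I.encode = x ∧ I.election.IsVoterInterval ∧ I.Solvable}

end ApprovalBribery

/-! After a successful bribery the approvers of `p` form an interval of voters `i, …, e - 1`. It
contains all original approvers of `p`, and its length `s = e - i` is the final score of `p`. There
are only quadratically many such intervals, so each can be tried. For a fixed one, exactly the
voters of the interval who do not yet approve `p` must give up one approval each (a plan). By an
exchange argument, `p` lies in a winning committee iff fewer than `k` candidates end with a score
above `s`. This reformulation is `solvable_iff`.

The cheapest plans are found by dynamic programming over prefixes `i, …, y - 1`, with one entry for
each number `q` of candidates pushed from above `s` to at most `s`. If the voter `y - 1` already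
approves `p`, the entry is copied. Otherwise the last run of voters `x, …, y - 1` giving up the same
candidate `c` must sit at an end of the approval interval of `c` (`IsPlan.exists_segment`);
conversely, any such segment extends a plan (`IsPlan.extend`).

The danger is that `c` may lose approvals at both ends, so that the table would have to remember
earlier losses. The key fact `loss_eq_zero` removes it: a candidate with score above `s` cannot have
lost anything before, since otherwise its whole approval interval would fit into `i, …, y - 1`,
which has at most `s` voters. Hence the counter `q` is additive over segments (`neut_segment`), and
the recurrence is correct (`isOptimum_tableStep`).

For the machine model, a small calculus of functions and memory transformations built from
arithmetic, branching and loops of exactly `N` rounds, with `N` the input length, is shown to run in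
polynomially many steps. Since a step adds at most one binary digit to the stored numbers, the
logarithmic cost is polynomial too (`inP_of_compP`). -/

namespace ApprovalBribery

/-! ### Step counts -/

/-- `P` takes `s` to `s'` in `u` steps: each step lengthens the stored numbers by at most one
digit, so that the logarithmic cost is bounded in terms of `u` and the initial lengths. -/
def Runs (P : RAMProg) (s s' : RAMState) (u : ℕ) : Prop :=
  ∀ b, (∀ r, Nat.size (s.reg r) ≤ b) → (∀ i, Nat.size (s.mem i) ≤ b) →
    (∀ r, Nat.size (s'.reg r) ≤ b + u) ∧ (∀ i, Nat.size (s'.mem i) ≤ b + u) ∧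
      ∃ t ≤ u * (2 * (b + u) + 1), RAMExec P s s' t

namespace Runs

variable {P Q : RAMProg} {s s' s'' : RAMState} {u v : ℕ}

theorem mono (h : Runs P s s' u) (huv : u ≤ v) : Runs P s s' v := by
  intro b hr hm
  obtain ⟨h1, h2, t, ht, hx⟩ := h b hr hm
  exact ⟨fun r => (h1 r).trans (by omega), fun r => (h2 r).trans (by omega), t,
    ht.trans (by gcongr), hx⟩

/-- The second run starts from lengths at most `b + u`, so both costs are dominated by the cost per
step at length `b + (u + v)`. Step counts thus add up without any tracking of lengths. -/
theorem seq (h : Runs P s s' u) (h' : Runs Q s' s'' v) : Runs (.seq P Q) s s'' (u + v) := by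
  intro b hr hm
  obtain ⟨h1, h2, t, ht, hx⟩ := h b hr hm
  obtain ⟨h3, h4, t', ht', hx'⟩ := h' _ h1 h2
  refine ⟨fun r => (h3 r).trans (by omega), fun r => (h4 r).trans (by omega), _, ?_, hx.seq hx'⟩
  calc t + t' ≤ u * (2 * (b + (u + v)) + 1) + v * (2 * (b + (u + v)) + 1) := by
        gcongr
        · refine ht.trans ?_
          gcongr
          omega
        · refine ht'.trans (le_of_eq ?_)
          ring
    _ = _ := by ring

theorem setReg_size {r a b c : ℕ} (hr : ∀ r, Nat.size (s.reg r) ≤ b) (ha : Nat.size a ≤ c)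
    (hbc : b ≤ c) (i : ℕ) : Nat.size ((s.setReg r a).reg i) ≤ c := by
  by_cases h : i = r
  · simpa [RAMState.setReg, h] using ha
  · simpa [RAMState.setReg, h] using (hr i).trans hbc

theorem skip (s : RAMState) : Runs .skip s s 1 := fun b hr hm =>
  ⟨fun r => (hr r).trans (by omega), fun r => (hm r).trans (by omega), 1, by omega, .skip s⟩

/-- A literal may be longer than every stored number, so it counts for as many steps as it has
digits, plus one. -/
theorem const (s : RAMState) (r a : ℕ) : Runs (.const r a) s (s.setReg r a) (1 + Nat.size a) :=
  fun b hr hm =>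
  ⟨setReg_size hr (by omega) (by omega), fun r => (hm r).trans (by omega), _,
    Nat.le_mul_of_pos_right _ (by omega), .const s r a⟩

theorem size_add_le {a b c : ℕ} (ha : Nat.size a ≤ c) (hb : Nat.size b ≤ c) :
    Nat.size (a + b) ≤ c + 1 := by
  rw [Nat.size_le] at *
  rw [pow_succ]
  omega

theorem add (s : RAMState) (r i j : ℕ) :
    Runs (.add r i j) s (s.setReg r (s.reg i + s.reg j)) 1 := fun b hr hm =>
  ⟨setReg_size hr (size_add_le (hr i) (hr j)) (by omega), fun r => (hm r).trans (by omega), _,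
    by have := hr i; have := hr j; omega, .add s r i j⟩

theorem sub (s : RAMState) (r i j : ℕ) :
    Runs (.sub r i j) s (s.setReg r (s.reg i - s.reg j)) 1 := fun b hr hm =>
  ⟨setReg_size hr ((Nat.size_le_size (Nat.sub_le _ _)).trans ((hr i).trans (by omega))) (by omega),
    fun r => (hm r).trans (by omega), _,
    by have := hr i; have := hr j; omega, .sub s r i j⟩

theorem load (s : RAMState) (r i : ℕ) :
    Runs (.load r i) s (s.setReg r (s.mem (s.reg i))) 1 := fun b hr hm =>
  ⟨setReg_size hr ((hm _).trans (by omega)) (by omega), fun r => (hm r).trans (by omega), _,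
    by have := hr i; have := hm (s.reg i); omega, .load s r i⟩

theorem store (s : RAMState) (r i : ℕ) :
    Runs (.store r i) s (s.setMem (s.reg r) (s.reg i)) 1 := fun b hr hm => by
  refine ⟨fun r => (hr r).trans (by omega), fun a => ?_, _, ?_, .store s r i⟩
  · by_cases h : a = s.reg r
    · simpa [RAMState.setMem, h] using (hr i).trans (by omega)
    · simpa [RAMState.setMem, h] using (hm a).trans (by omega)
  · have := hr i; have := hr r; omega

theorem ite_true {r : ℕ} (hr : s.reg r ≠ 0) (h : Runs P s s' u) :
    Runs (.ite r P Q) s s' (1 + u) := by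
  intro b h1 h2
  obtain ⟨h3, h4, t, ht, hx⟩ := h b h1 h2
  refine ⟨fun r => (h3 r).trans (by omega), fun r => (h4 r).trans (by omega), _, ?_,
    .ite_true hr hx⟩
  have := h1 r
  nlinarith

theorem ite_false {r : ℕ} (hr : s.reg r = 0) (h : Runs Q s s' u) :
    Runs (.ite r P Q) s s' (1 + u) := by
  intro b h1 h2
  obtain ⟨h3, h4, t, ht, hx⟩ := h b h1 h2
  refine ⟨fun r => (h3 r).trans (by omega), fun r => (h4 r).trans (by omega), _, ?_,
    .ite_false hr hx⟩
  have := h1 r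
  nlinarith

theorem while_false {r : ℕ} (hr : s.reg r = 0) : Runs (.while r P) s s 1 := by
  intro b h1 h2
  refine ⟨fun r => (h1 r).trans (by omega), fun r => (h2 r).trans (by omega), _, ?_,
    .while_false hr⟩
  have := h1 r
  omega

theorem while_true {r : ℕ} (hr : s.reg r ≠ 0) (h : Runs P s s' u)
    (h' : Runs (.while r P) s' s'' v) : Runs (.while r P) s s'' (1 + u + v) := by
  intro b h1 h2
  obtain ⟨h3, h4, t, ht, hx⟩ := h b h1 h2
  obtain ⟨h5, h6, t', ht', hx'⟩ := h' _ h3 h4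
  refine ⟨fun r => (h5 r).trans (by omega), fun r => (h6 r).trans (by omega), _, ?_,
    .while_true hr hx hx'⟩
  have h7 := h1 r
  have h8 : u * (2 * (b + u) + 1) ≤ u * (2 * (b + (1 + u + v)) + 1) :=
    Nat.mul_le_mul le_rfl (by omega)
  have h9 : v * (2 * (b + u + v) + 1) ≤ v * (2 * (b + (1 + u + v)) + 1) :=
    Nat.mul_le_mul le_rfl (by omega)
  have h10 : (1 + u + v) * (2 * (b + (1 + u + v)) + 1) = (2 * (b + (1 + u + v)) + 1) +
      u * (2 * (b + (1 + u + v)) + 1) + v * (2 * (b + (1 + u + v)) + 1) := by ring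
  omega

/-- A loop that is controlled by a counter. -/
theorem while_counter {c N : ℕ} (J : ℕ → RAMState → Prop)
    (hstep : ∀ i s, i < N → J i s → s.reg c = N - i →
      ∃ s', Runs P s s' u ∧ J (i + 1) s' ∧ s'.reg c = N - (i + 1))
    (h0 : J 0 s) (hc : s.reg c = N) :
    ∃ s', Runs (.while c P) s s' (N * (1 + u) + 1) ∧ J N s' := by
  -- Induction on the number `k` of remaining rounds. Each round pays for its body and one test; the
  -- failing test at the end accounts for the last `+ 1`.
  have key : ∀ k i s, i + k = N → J i s → s.reg c = N - i →
      ∃ s', Runs (.while c P) s s' (k * (1 + u) + 1) ∧ J N s' := by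
    intro k
    induction k with
    | zero =>
      intro i s hi hJ hc
      obtain rfl : i = N := by omega
      exact ⟨s, by simpa using while_false (by omega), hJ⟩
    | succ k ih =>
      intro i s hi hJ hc
      obtain ⟨s', hr, hJ', hc'⟩ := hstep i s (by omega) hJ hc
      obtain ⟨s'', hr', hJ''⟩ := ih (i + 1) s' (by omega) hJ' hc'
      refine ⟨s'', (while_true (by omega) hr hr').mono (le_of_eq ?_), hJ''⟩
      ring
  exact key N 0 s (by omega) h0 (by omega)

end Runs

/-! ### Polynomial time programs with loops of the length of the input -/

/-- Tuples of natural numbers, as contents of registers. -/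
class Env (α : Type) where
  /-- an assignment of registers to the components -/
  Layout : Type
  /-- all registers of the layout are below a bound -/
  below : Layout → ℕ → Prop
  /-- the registers of the layout hold the components of the tuple -/
  holds : Layout → (ℕ → ℕ) → α → Prop
  mono : ∀ {L t t'}, below L t → t ≤ t' → below L t'
  congr : ∀ {L t ρ ρ' a}, below L t → (∀ r < t, ρ' r = ρ r) → holds L ρ a → holds L ρ' a

instance : Env Unit where
  Layout := Unit
  below _ _ := True
  holds _ _ _ := True
  mono _ _ := trivial
  congr _ _ _ := trivial

instance {α : Type} [Env α] : Env (α × ℕ) where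
  Layout := Env.Layout α × ℕ
  below L t := Env.below L.1 t ∧ L.2 < t
  holds L ρ a := Env.holds L.1 ρ a.1 ∧ ρ L.2 = a.2
  mono h ht := ⟨Env.mono h.1 ht, h.2.trans_le ht⟩
  congr h hρ H := ⟨Env.congr h.1 hρ H.1, (hρ _ h.2).trans H.2⟩

variable {α : Type} [Env α]

/-- A program computes, from the tuple `a` in registers, the memory `μ`, and the number `N` in
register `0`, the value `f N μ a` in a number of steps polynomial in `N`. -/
def Comp (f : ℕ → (ℕ → ℕ) → α → ℕ) : Prop :=
  ∀ (L : Env.Layout α) (t : ℕ), 1 ≤ t → Env.below L t → ∃ (P : RAMProg) (q : Polynomial ℕ),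
    ∀ (s : RAMState) (a : α), Env.holds L s.reg a →
      ∃ s', Runs P s s' (q.eval (s.reg 0)) ∧ s'.reg t = f (s.reg 0) s.mem a ∧
        (∀ r < t, s'.reg r = s.reg r) ∧ s'.mem = s.mem

/-- A program decides a predicate in a polynomial number of steps. -/
def CompP (p : ℕ → (ℕ → ℕ) → α → Prop) : Prop :=
  ∃ f : ℕ → (ℕ → ℕ) → α → ℕ, Comp f ∧ ∀ N μ a, p N μ a ↔ f N μ a ≠ 0

/-- A program transforms the memory in a polynomial number of steps. -/
def CompC (F : ℕ → (ℕ → ℕ) → α → ℕ → ℕ) : Prop :=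
  ∀ (L : Env.Layout α) (t : ℕ), 1 ≤ t → Env.below L t → ∃ (P : RAMProg) (q : Polynomial ℕ),
    ∀ (s : RAMState) (a : α), Env.holds L s.reg a →
      ∃ s', Runs P s s' (q.eval (s.reg 0)) ∧ (∀ r < t, s'.reg r = s.reg r) ∧
        s'.mem = F (s.reg 0) s.mem a

/-! ### Closure properties of functions computable in polynomially many steps -/

namespace Comp

variable {f g : ℕ → (ℕ → ℕ) → α → ℕ}

theorem const (k : ℕ) : Comp (fun _ _ (_ : α) => k) := fun L t ht _ =>
  ⟨.const t k, Polynomial.C (1 + Nat.size k), fun s a _ => ⟨_, (Runs.const s t k).mono (by simp),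
    by simp [RAMState.setReg], fun r hr => by simp [RAMState.setReg, hr.ne], rfl⟩⟩

theorem length : Comp (fun N _ (_ : α) => N) := fun L t ht _ =>
  -- A register is copied by adding it to a register that was set to zero.
  ⟨.seq (.const t 0) (.add t t 0), 2, fun s a _ =>
    ⟨_, ((Runs.const s t 0).seq (Runs.add _ t t 0)).mono (by simp),
    by simp [RAMState.setReg, (show 0 ≠ t by omega)],
    fun r hr => by simp [RAMState.setReg, hr.ne], rfl⟩⟩

theorem snd : Comp (fun _ _ (x : α × ℕ) => x.2) := fun L t ht hL =>
  ⟨.seq (.const t 0) (.add t t L.2), 2, fun s a ha =>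
    ⟨_, ((Runs.const s t 0).seq (Runs.add _ t t L.2)).mono (by simp),
    by simp [RAMState.setReg, hL.2.ne, ha.2],
    fun r hr => by simp [RAMState.setReg, hr.ne], rfl⟩⟩

theorem fst (hf : Comp f) : Comp (fun N μ (x : α × ℕ) => f N μ x.1) := fun L t ht hL => by
  obtain ⟨P, q, hP⟩ := hf L.1 t ht hL.1
  exact ⟨P, q, fun s a ha => hP s a.1 ha.1⟩

/-- The common part of the rules for binary operations. -/
theorem binary {op : ℕ → ℕ → ℕ} (I : ℕ → ℕ → ℕ → RAMProg)
    (hI : ∀ r i j s, Runs (I r i j) s (s.setReg r (op (s.reg i) (s.reg j))) 1)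
    (hf : Comp f) (hg : Comp g) : Comp (fun N μ a => op (f N μ a) (g N μ a)) := fun L t ht hL => by
  obtain ⟨P, q, hP⟩ := hf L t ht hL
  obtain ⟨Q, q', hQ⟩ := hg L (t + 1) (by omega) (Env.mono hL (by omega))
  refine ⟨.seq (.seq P Q) (I t t (t + 1)), q + q' + 1, fun s a ha => ?_⟩
  obtain ⟨s1, h1, h2, h3, h4⟩ := hP s a ha
  obtain ⟨s2, h5, h6, h7, h8⟩ := hQ s1 a (Env.congr hL h3 ha)
  have h0 := h3 0 (by omega)
  refine ⟨_, ((h1.seq h5).seq (hI t t (t + 1) s2)).mono (by simp [h0]), ?_, ?_, ?_⟩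
  · simp [RAMState.setReg, h6, h0, h4, h7 t (by omega), h2]
  · intro r hr
    simp [RAMState.setReg, hr.ne, h7 r (by omega), h3 r hr]
  · simp [RAMState.setReg, h8, h4]

theorem add (hf : Comp f) (hg : Comp g) : Comp (fun N μ a => f N μ a + g N μ a) :=
  binary .add (fun r i j s => Runs.add s r i j) hf hg

theorem sub (hf : Comp f) (hg : Comp g) : Comp (fun N μ a => f N μ a - g N μ a) :=
  binary .sub (fun r i j s => Runs.sub s r i j) hf hg

theorem load (hf : Comp f) : Comp (fun N μ a => μ (f N μ a)) := fun L t ht hL => by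
  obtain ⟨P, q, hP⟩ := hf L t ht hL
  refine ⟨.seq P (.load t t), q + 1, fun s a ha => ?_⟩
  obtain ⟨s1, h1, h2, h3, h4⟩ := hP s a ha
  refine ⟨_, (h1.seq (Runs.load s1 t t)).mono (by simp), ?_, ?_, ?_⟩
  · simp [RAMState.setReg, h2, h4]
  · intro r hr
    simp [RAMState.setReg, hr.ne, h3 r hr]
  · simp [RAMState.setReg, h4]

theorem min (hf : Comp f) (hg : Comp g) : Comp (fun N μ a => min (f N μ a) (g N μ a)) := by
  have : (fun N μ a => Min.min (f N μ a) (g N μ a)) =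
      fun N μ a => f N μ a - (f N μ a - g N μ a) := by
    funext N μ a
    omega
  rw [this]
  exact hf.sub (hf.sub hg)

theorem ite {p : ℕ → (ℕ → ℕ) → α → Prop} {inst : ∀ N μ a, Decidable (p N μ a)} (hp : CompP p)
    (hf : Comp f) (hg : Comp g) : Comp (fun N μ a => if p N μ a then f N μ a else g N μ a) := by
  obtain ⟨h, hh, hhp⟩ := hp
  intro L t ht hL
  obtain ⟨P, q, hP⟩ := hh L t ht hL
  obtain ⟨Q, q', hQ⟩ := hf L t ht hL
  obtain ⟨R, q'', hR⟩ := hg L t ht hL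
  refine ⟨.seq P (.ite t Q R), q + (1 + (q' + q'')), fun s a ha => ?_⟩
  obtain ⟨s1, h1, h2, h3, h4⟩ := hP s a ha
  have h0 := h3 0 (by omega)
  by_cases hpa : p (s.reg 0) s.mem a
  · obtain ⟨s2, h5, h6, h7, h8⟩ := hQ s1 a (Env.congr hL h3 ha)
    refine ⟨s2, (h1.seq (Runs.ite_true ?_ h5)).mono (by simp [h0]), ?_, ?_, h8.trans h4⟩
    · rw [h2]
      exact (hhp _ _ _).1 hpa
    · simp [h6, h0, h4, hpa]
    · intro r hr
      rw [h7 r hr, h3 r hr]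
  · obtain ⟨s2, h5, h6, h7, h8⟩ := hR s1 a (Env.congr hL h3 ha)
    refine ⟨s2, (h1.seq (Runs.ite_false ?_ h5)).mono (by simp [h0]), ?_, ?_, h8.trans h4⟩
    · rw [h2]
      exact not_not.1 ((hhp _ _ _).not.1 hpa)
    · simp [h6, h0, h4, hpa]
    · intro r hr
      rw [h7 r hr, h3 r hr]

/-- Iterate `N` times. -/
theorem fold {g : ℕ → (ℕ → ℕ) → α → ℕ → ℕ → ℕ} (hf : Comp f)
    (hg : Comp (fun N μ (x : (α × ℕ) × ℕ) => g N μ x.1.1 x.1.2 x.2)) :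
    Comp (fun N μ a => Nat.rec (f N μ a) (fun i b => g N μ a i b) N) := fun L t ht hL => by
  obtain ⟨P, q, hP⟩ := hf L t ht hL
  -- Register `t` holds the accumulator, `t + 1` the index, `t + 2` the number of remaining rounds
  -- and `t + 3` the constant one; the body leaves its value in `t + 4`.
  obtain ⟨Q, q', hQ⟩ := hg ((L, t + 1), t) (t + 4) (by omega)
    ⟨⟨Env.mono hL (by omega), by simp⟩, by simp⟩
  refine ⟨.seq (.seq P (.seq (.seq (.const (t + 1) 0) (.const (t + 3) 1))
      (.seq (.const (t + 2) 0) (.add (t + 2) (t + 2) 0))))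
    (.while (t + 2) (.seq Q (.seq (.seq (.const t 0) (.add t t (t + 4)))
      (.seq (.add (t + 1) (t + 1) (t + 3)) (.sub (t + 2) (t + 2) (t + 3)))))),
    q + 5 + (Polynomial.X * (1 + (q' + 4)) + 1), fun s a ha => ?_⟩
  obtain ⟨s1, h1, h2, h3, h4⟩ := hP s a ha
  have h0 := h3 0 (by omega)
  have hinit := h1.seq (((Runs.const _ (t + 1) 0).seq (Runs.const _ (t + 3) 1)).seq
    ((Runs.const _ (t + 2) 0).seq (Runs.add _ (t + 2) (t + 2) 0)))
  have hne : 0 ≠ t := by omega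
  obtain ⟨s', hs', hJ⟩ := Runs.while_counter (c := t + 2) (N := s.reg 0)
    (u := q'.eval (s.reg 0) + 4)
    (fun i σ => (∀ r < t, σ.reg r = s.reg r) ∧ σ.mem = s.mem ∧ σ.reg (t + 1) = i ∧
      σ.reg (t + 3) = 1 ∧
      σ.reg t = Nat.rec (f (s.reg 0) s.mem a) (fun i b => g (s.reg 0) s.mem a i b) i)
    (P := .seq Q (.seq (.seq (.const t 0) (.add t t (t + 4)))
      (.seq (.add (t + 1) (t + 1) (t + 3)) (.sub (t + 2) (t + 2) (t + 3)))))
    (by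
      rintro i σ hi ⟨e1, e2, e3, e4, e5⟩ e6
      obtain ⟨σ', k1, k2, k3, k4⟩ := hQ σ ((a, i), σ.reg t)
        ⟨⟨Env.congr hL e1 ha, e3⟩, rfl⟩
      have e0 := e1 0 (by omega)
      refine ⟨_, (k1.seq (((Runs.const _ t 0).seq (Runs.add _ t t (t + 4))).seq
        ((Runs.add _ (t + 1) (t + 1) (t + 3)).seq (Runs.sub _ (t + 2) (t + 2) (t + 3))))).mono
        (by simp [e0]), ⟨?_, ?_, ?_, ?_, ?_⟩, ?_⟩
      · intro r hr
        simp [RAMState.setReg, hr.ne, (show r ≠ t + 1 by omega), (show r ≠ t + 2 by omega),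
          k3 r (by omega), e1 r hr]
      · simp [RAMState.setReg, k4, e2]
      · simp [RAMState.setReg, k3, e3, e4]
      · simp [RAMState.setReg, k3, e4]
      · simp [RAMState.setReg, k2, e0, e2, e5]
      · simp [RAMState.setReg, k3, e6, e4]
        omega)
    (s := ((((s1.setReg (t + 1) 0).setReg (t + 3) 1).setReg (t + 2) 0).setReg (t + 2) (s.reg 0)))
    ⟨by
      intro r hr
      simp [RAMState.setReg, (show r ≠ t + 1 by omega), (show r ≠ t + 2 by omega),
        (show r ≠ t + 3 by omega), h3 r hr],
      by simp [RAMState.setReg, h4], by simp [RAMState.setReg], by simp [RAMState.setReg],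
      by simp [RAMState.setReg, h2]⟩
    (by simp [RAMState.setReg])
  refine ⟨s', (hinit.seq ?_).mono (u := (q.eval (s.reg 0) + 5)
    + (s.reg 0 * (1 + (q'.eval (s.reg 0) + 4)) + 1)) ?_, hJ.2.2.2.2, hJ.1, hJ.2.1⟩
  · convert hs' using 1
    simp [RAMState.setReg, h0]
  · simp

theorem sum {g : ℕ → (ℕ → ℕ) → α → ℕ → ℕ} (hg : Comp (fun N μ (x : α × ℕ) => g N μ x.1 x.2)) :
    Comp (fun N μ a => ∑ i ∈ Finset.range N, g N μ a i) := by
  have : (fun N μ a => ∑ i ∈ Finset.range N, g N μ a i) =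
      fun N μ a => Nat.rec 0 (fun i b => b + g N μ a i) N := by
    funext N μ a
    generalize hM : g N μ a = φ
    clear hM
    induction N with
    | zero => rfl
    | succ N ih => rw [Finset.sum_range_succ, ih]
  rw [this]
  exact fold (g := fun N μ a i b => b + g N μ a i) (const 0) (snd.add hg.fst)

end Comp

/-! ### Closure properties of predicates -/

namespace CompP

variable {f g : ℕ → (ℕ → ℕ) → α → ℕ} {p p' : ℕ → (ℕ → ℕ) → α → Prop}

/-- Truth is a nonzero value: comparisons become truncated differences, conjunction a minimum,
disjunction a sum, and bounded existence a sum over all indices. -/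
theorem lt (hf : Comp f) (hg : Comp g) : CompP (fun N μ a => f N μ a < g N μ a) :=
  ⟨_, hg.sub hf, fun N μ a => by omega⟩

theorem le (hf : Comp f) (hg : Comp g) : CompP (fun N μ a => f N μ a ≤ g N μ a) :=
  ⟨_, (hg.add (.const 1)).sub hf, fun N μ a => by omega⟩

theorem not (hp : CompP p) : CompP (fun N μ a => ¬ p N μ a) := by
  obtain ⟨f, hf, h⟩ := hp
  exact ⟨_, (Comp.const 1).sub hf, fun N μ a => by simp only [h]; omega⟩

theorem and (hp : CompP p) (hp' : CompP p') : CompP (fun N μ a => p N μ a ∧ p' N μ a) := by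
  obtain ⟨f, hf, h⟩ := hp
  obtain ⟨f', hf', h'⟩ := hp'
  exact ⟨_, hf.min hf', fun N μ a => by simp only [h, h']; omega⟩

theorem or (hp : CompP p) (hp' : CompP p') : CompP (fun N μ a => p N μ a ∨ p' N μ a) := by
  obtain ⟨f, hf, h⟩ := hp
  obtain ⟨f', hf', h'⟩ := hp'
  exact ⟨_, hf.add hf', fun N μ a => by simp only [h, h']; omega⟩

theorem imp (hp : CompP p) (hp' : CompP p') : CompP (fun N μ a => p N μ a → p' N μ a) := by
  simp only [imp_iff_not_or]
  exact hp.not.or hp'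

theorem eq (hf : Comp f) (hg : Comp g) : CompP (fun N μ a => f N μ a = g N μ a) := by
  simp only [le_antisymm_iff]
  exact (le hf hg).and (le hg hf)

theorem bex {p : ℕ → (ℕ → ℕ) → α → ℕ → Prop} (hp : CompP (fun N μ (x : α × ℕ) => p N μ x.1 x.2)) :
    CompP (fun N μ a => ∃ i < N, p N μ a i) := by
  obtain ⟨f, hf, h⟩ := hp
  refine ⟨_, Comp.sum (g := fun N μ a i => f N μ (a, i)) hf, fun N μ a => ?_⟩
  simp [h N μ (a, _)]

theorem ball {p : ℕ → (ℕ → ℕ) → α → ℕ → Prop} (hp : CompP (fun N μ (x : α × ℕ) => p N μ x.1 x.2)) :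
    CompP (fun N μ a => ∀ i < N, p N μ a i) := by
  convert (bex (p := fun N μ a i => ¬ p N μ a i) hp.not).not using 4
  simp

end CompP

namespace Comp

variable {f g : ℕ → (ℕ → ℕ) → α → ℕ}

/-- The machine has no multiplication. A loop of `N` rounds can add `g` at most `N` times, whence
the cap on the first factor; it is harmless for voters and table rows below `N`. -/
theorem mul (hf : Comp f) (hg : Comp g) :
    Comp (fun N μ a => Min.min (f N μ a) N * g N μ a) := by
  have : (fun N μ a => Min.min (f N μ a) N * g N μ a) =
      fun N μ a => ∑ i ∈ Finset.range N, if i < f N μ a then g N μ a else 0 := by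
    funext N μ a
    rw [← Finset.sum_filter, Finset.sum_const, smul_eq_mul]
    congr 1
    rw [show (Finset.range N).filter (· < f N μ a) = Finset.range (Min.min (f N μ a) N) by
      ext i; simp; omega, Finset.card_range]
  rw [this]
  exact sum (ite (.lt snd hf.fst) hg.fst (const 0))

/-- The minimum of `b` and the values of `f` below `N`. -/
def _root_.ApprovalBribery.minBelow (b : ℕ) (f : ℕ → ℕ) (N : ℕ) : ℕ :=
  Nat.rec b (fun i c => Min.min c (f i)) N

theorem minBelow {g : ℕ → (ℕ → ℕ) → α → ℕ → ℕ} (hf : Comp f)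
    (hg : Comp (fun N μ (x : α × ℕ) => g N μ x.1 x.2)) :
    Comp (fun N μ a => ApprovalBribery.minBelow (f N μ a) (fun i => g N μ a i) N) :=
  fold (g := fun N μ a i b => Min.min b (g N μ a i)) hf (snd.min hg.fst)

end Comp

/-- Table entries matter only through comparisons with thresholds, for which a minimum becomes an
existential statement. -/
theorem minBelow_le_iff {b : ℕ} {f : ℕ → ℕ} {N W : ℕ} :
    minBelow b f N ≤ W ↔ b ≤ W ∨ ∃ i < N, f i ≤ W := by
  induction N with
  | zero => simp [minBelow]
  | succ N ih =>
    rw [show minBelow b f (N + 1) = min (minBelow b f N) (f N) from rfl, min_le_iff, ih]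
    simp only [Nat.lt_succ_iff_lt_or_eq, or_and_right, exists_or, exists_eq_left, or_assoc]

/-! ### Closure properties of memory transformations -/

namespace CompC

theorem store {f g : ℕ → (ℕ → ℕ) → α → ℕ} (hf : Comp f) (hg : Comp g) :
    CompC (fun N μ a => Function.update μ (f N μ a) (g N μ a)) := fun L t ht hL => by
  obtain ⟨P, q, hP⟩ := hf L t ht hL
  obtain ⟨Q, q', hQ⟩ := hg L (t + 1) (by omega) (Env.mono hL (by omega))
  refine ⟨.seq (.seq P Q) (.store t (t + 1)), q + q' + 1, fun s a ha => ?_⟩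
  obtain ⟨s1, h1, h2, h3, h4⟩ := hP s a ha
  obtain ⟨s2, h5, h6, h7, h8⟩ := hQ s1 a (Env.congr hL h3 ha)
  have h0 := h3 0 (by omega)
  refine ⟨_, ((h1.seq h5).seq (Runs.store s2 t (t + 1))).mono (by simp [h0]), ?_, ?_⟩
  · intro r hr
    simp [RAMState.setMem, h7 r (by omega), h3 r hr]
  · simp [RAMState.setMem, h6, h0, h4, h7 t (by omega), h2, h8]

theorem skip : CompC (fun _ μ (_ : α) => μ) := fun L t ht hL =>
  ⟨.skip, 1, fun s a ha => ⟨s, (Runs.skip s).mono (by simp), fun _ _ => rfl, rfl⟩⟩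

theorem seq {F G : ℕ → (ℕ → ℕ) → α → ℕ → ℕ} (hF : CompC F) (hG : CompC G) :
    CompC (fun N μ a => G N (F N μ a) a) := fun L t ht hL => by
  obtain ⟨P, q, hP⟩ := hF L t ht hL
  obtain ⟨Q, q', hQ⟩ := hG L t ht hL
  refine ⟨.seq P Q, q + q', fun s a ha => ?_⟩
  obtain ⟨s1, h1, h3, h4⟩ := hP s a ha
  obtain ⟨s2, h5, h7, h8⟩ := hQ s1 a (Env.congr hL h3 ha)
  have h0 := h3 0 (by omega)
  exact ⟨_, (h1.seq h5).mono (by simp [h0]), fun r hr => (h7 r hr).trans (h3 r hr),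
    by rw [h8, h4, h0]⟩

theorem ite {p : ℕ → (ℕ → ℕ) → α → Prop} {inst : ∀ N μ a, Decidable (p N μ a)}
    {F G : ℕ → (ℕ → ℕ) → α → ℕ → ℕ} (hp : CompP p) (hF : CompC F) (hG : CompC G) :
    CompC (fun N μ a => if p N μ a then F N μ a else G N μ a) := by
  obtain ⟨h, hh, hhp⟩ := hp
  intro L t ht hL
  obtain ⟨P, q, hP⟩ := hh L t ht hL
  obtain ⟨Q, q', hQ⟩ := hF L t ht hL
  obtain ⟨R, q'', hR⟩ := hG L t ht hL
  refine ⟨.seq P (.ite t Q R), q + (1 + (q' + q'')), fun s a ha => ?_⟩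
  obtain ⟨s1, h1, h2, h3, h4⟩ := hP s a ha
  have h0 := h3 0 (by omega)
  by_cases hpa : p (s.reg 0) s.mem a
  · obtain ⟨s2, h5, h7, h8⟩ := hQ s1 a (Env.congr hL h3 ha)
    refine ⟨s2, (h1.seq (Runs.ite_true ?_ h5)).mono (by simp [h0]), ?_, ?_⟩
    · rw [h2]
      exact (hhp _ _ _).1 hpa
    · intro r hr
      rw [h7 r hr, h3 r hr]
    · simp [h8, h0, h4, hpa]
  · obtain ⟨s2, h5, h7, h8⟩ := hR s1 a (Env.congr hL h3 ha)
    refine ⟨s2, (h1.seq (Runs.ite_false ?_ h5)).mono (by simp [h0]), ?_, ?_⟩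
    · rw [h2]
      exact not_not.1 ((hhp _ _ _).not.1 hpa)
    · intro r hr
      rw [h7 r hr, h3 r hr]
    · simp [h8, h0, h4, hpa]

/-- Iterate `N` times. -/
theorem loop {F : ℕ → (ℕ → ℕ) → α → ℕ → ℕ → ℕ}
    (hF : CompC (fun N μ (x : α × ℕ) => F N μ x.1 x.2)) :
    CompC (fun N μ a => Nat.rec μ (fun i μ' => F N μ' a i) N) := fun L t ht hL => by
  -- Register `t` is the index, `t + 1` the number of remaining rounds and `t + 2` the constant one;
  -- the body may use everything from `t + 3` on.
  obtain ⟨Q, q', hQ⟩ := hF (L, t) (t + 3) (by omega) ⟨Env.mono hL (by omega), by simp⟩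
  refine ⟨.seq (.seq (.seq (.const t 0) (.const (t + 2) 1))
      (.seq (.const (t + 1) 0) (.add (t + 1) (t + 1) 0)))
    (.while (t + 1) (.seq Q (.seq (.add t t (t + 2)) (.sub (t + 1) (t + 1) (t + 2))))),
    5 + (Polynomial.X * (1 + (q' + 2)) + 1), fun s a ha => ?_⟩
  have hinit := ((Runs.const s t 0).seq (Runs.const _ (t + 2) 1)).seq
    ((Runs.const _ (t + 1) 0).seq (Runs.add _ (t + 1) (t + 1) 0))
  have hne : 0 ≠ t := by omega
  obtain ⟨s', hs', hJ⟩ := Runs.while_counter (c := t + 1) (N := s.reg 0)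
    (u := q'.eval (s.reg 0) + 2)
    (fun i σ => (∀ r < t, σ.reg r = s.reg r) ∧ σ.reg t = i ∧ σ.reg (t + 2) = 1 ∧
      σ.mem = Nat.rec s.mem (fun i μ' => F (s.reg 0) μ' a i) i)
    (P := .seq Q (.seq (.add t t (t + 2)) (.sub (t + 1) (t + 1) (t + 2))))
    (by
      rintro i σ hi ⟨e1, e3, e4, e5⟩ e6
      obtain ⟨σ', k1, k3, k4⟩ := hQ σ (a, i) ⟨Env.congr hL e1 ha, e3⟩
      have e0 := e1 0 (by omega)
      refine ⟨_, (k1.seq ((Runs.add _ t t (t + 2)).seq (Runs.sub _ (t + 1) (t + 1) (t + 2)))).mono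
        (by simp [e0]), ⟨?_, ?_, ?_, ?_⟩, ?_⟩
      · intro r hr
        simp [RAMState.setReg, hr.ne, (show r ≠ t + 1 by omega), k3 r (by omega), e1 r hr]
      · simp [RAMState.setReg, k3, e3, e4]
      · simp [RAMState.setReg, k3, e4]
      · simp [RAMState.setReg, k4, e0, e5]
      · simp [RAMState.setReg, k3, e6, e4]
        omega)
    (s := (((s.setReg t 0).setReg (t + 2) 1).setReg (t + 1) 0).setReg (t + 1) (s.reg 0))
    ⟨by
      intro r hr
      simp [RAMState.setReg, hr.ne, (show r ≠ t + 1 by omega), (show r ≠ t + 2 by omega)],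
      by simp [RAMState.setReg], by simp [RAMState.setReg], by simp [RAMState.setReg]⟩
    (by simp [RAMState.setReg])
  refine ⟨s', (hinit.seq ?_).mono (u := 5 + (s.reg 0 * (1 + (q'.eval (s.reg 0) + 2)) + 1)) ?_,
    hJ.1, hJ.2.2.2⟩
  · convert hs' using 1
    simp [RAMState.setReg, hne]
  · simp

end CompC

/-! ### Membership in P -/

theorem size_le_inputSize {x : List ℕ} {a : ℕ} (h : a ∈ x) : Nat.size a ≤ inputSize x := by
  have := List.single_le_sum (l := x.map fun a => Nat.size a + 1) (by simp) (Nat.size a + 1)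
    (List.mem_map_of_mem h)
  unfold inputSize
  omega

theorem length_le_inputSize (x : List ℕ) : x.length ≤ inputSize x := by
  induction x with
  | nil => simp
  | cons a x ih =>
    simp only [inputSize, List.map_cons, List.sum_cons, List.length_cons] at *
    omega

theorem eval_mono (P : Polynomial ℕ) {a b : ℕ} (h : a ≤ b) : P.eval a ≤ P.eval b := by
  rw [Polynomial.eval_eq_sum, Polynomial.eval_eq_sum]
  exact Finset.sum_le_sum fun i _ => Nat.mul_le_mul le_rfl (Nat.pow_le_pow_left h i)

/-- A language is in P if it is decided by a memory transformation followed by a test. -/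
theorem inP_of_compP {L : Set (List ℕ)} {F : ℕ → (ℕ → ℕ) → Unit → ℕ → ℕ}
    {p : ℕ → (ℕ → ℕ) → Unit → Prop} (hF : CompC F) (hp : CompP p)
    (h : ∀ x : List ℕ, x ∈ L ↔ p x.length (F x.length (fun i => x.getD i 0) ()) ()) : InP L := by
  classical
  have hg : Comp (fun N μ a => if p N μ a then 1 else 0) := .ite hp (.const 1) (.const 0)
  obtain ⟨P, q, hP⟩ := hF () 1 le_rfl trivial
  obtain ⟨Q, q', hQ⟩ := hg () 1 le_rfl trivial
  -- The summand `2` pays for copying the result from register `1` to register `0`. The logarithmic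
  -- cost comes from `Runs` with all initial digit lengths bounded by `inputSize x`.
  let r : Polynomial ℕ := q + q' + 2
  refine ⟨.seq (.seq P Q) (.seq (.const 0 0) (.add 0 0 1)),
    r * (2 * (Polynomial.X + r) + 1), fun x => ?_⟩
  obtain ⟨s1, h1, h3, h4⟩ := hP (RAMState.init x) () trivial
  obtain ⟨s2, h5, h6, h7, h8⟩ := hQ s1 () trivial
  have h0 := h3 0 (by omega)
  have hlen : (RAMState.init x).reg 0 = x.length := by simp [RAMState.init]
  rw [hlen] at h0 h1 h4
  rw [h0] at h5 h6
  have hrun := ((h1.seq h5).seq ((Runs.const _ 0 0).seq (Runs.add _ 0 0 1))).mono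
    (v := r.eval (inputSize x)) (by
      have hm := fun P : Polynomial ℕ => eval_mono P (length_le_inputSize x)
      have := hm q
      have := hm q'
      simp [r]
      omega)
  obtain ⟨-, -, t, ht, hx⟩ := hrun (inputSize x)
    (fun i => by
      by_cases hi : i = 0
      · subst hi
        rw [hlen]
        exact (Nat.size_le.2 Nat.lt_two_pow_self).trans (length_le_inputSize x)
      · simp [RAMState.init, hi])
    (fun i => by
      show Nat.size (x.getD i 0) ≤ _
      by_cases hi : i < x.length
      · rw [List.getD_eq_getElem _ _ hi]
        exact size_le_inputSize (List.getElem_mem hi)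
      · rw [List.getD_eq_default _ _ (by omega)]
        simp)
  refine ⟨_, t, hx, by simpa using ht, ?_⟩
  rw [h x]
  simp only [RAMState.setReg, h4, RAMState.init] at h6 ⊢
  simp [h6]

/-! ### Plans: whose approval each bribed voter moves -/

open Finset
open scoped Classical in
/-- The score of a candidate when `ap v c` states that voter `v` approves candidate `c`. -/
noncomputable def apScore (N : ℕ) (ap : ℕ → ℕ → Prop) (c : ℕ) : ℕ :=
  ∑ v ∈ range N, if ap v c then 1 else 0

/-- The voters `x, …, y - 1` do not approve `p`, they approve `c`, and they are the first or the
last ones to do so. -/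
def IsSegment (N p : ℕ) (ap : ℕ → ℕ → Prop) (i x y c : ℕ) : Prop :=
  i ≤ x ∧ x < y ∧ (∀ v < N, x ≤ v → v < y → ap v c ∧ ¬ ap v p) ∧
    ((x = 0 ∨ ¬ ap (x - 1) c) ∨ ¬ ap y c)

/-- The total price of the voters `x, …, y - 1` for the candidate `c`. -/
def segCost (N : ℕ) (pr : ℕ → ℕ → ℕ) (x y c : ℕ) : ℕ :=
  ∑ v ∈ range N, if x ≤ v ∧ v < y then pr v c else 0

open scoped Classical in
/-- Whether the loss of `y - x` approvals brings the score of `c` from above `s` to at most `s`. -/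
noncomputable def gain (N : ℕ) (ap : ℕ → ℕ → Prop) (s x y c : ℕ) : ℕ :=
  if s < apScore N ap c ∧ apScore N ap c ≤ s + (y - x) then 1 else 0

open scoped Classical in
/-- One entry of the table of the dynamic program, computed from the previous ones. -/
noncomputable def tableStep (N p B : ℕ) (ap : ℕ → ℕ → Prop) (pr : ℕ → ℕ → ℕ) (i s : ℕ)
    (tbl : ℕ → ℕ → ℕ) (y q : ℕ) : ℕ :=
  minBelow
    (if y = i ∧ q = 0 then 0 else if i < y ∧ ap (y - 1) p then tbl (y - 1) q else B + 1)
    (fun x => minBelow (B + 1) (fun c =>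
      if IsSegment N p ap i x y c ∧ gain N ap s x y c ≤ q then
        tbl x (q - gain N ap s x y c) + segCost N pr x y c else B + 1) N) N

/-- In the plan `f` for the voters `i, …, y - 1`, voter `v` moves an approval away from `c`. -/
def Removed (p : ℕ) (ap : ℕ → ℕ → Prop) (f : ℕ → ℕ) (i y c v : ℕ) : Prop :=
  i ≤ v ∧ v < y ∧ ¬ ap v p ∧ f v = c

/-- `f` assigns to the voters among `i, …, y - 1` who do not approve `p` candidates such that
moving the approvals away from these candidates leaves intervals. -/
structure IsPlan (p : ℕ) (ap : ℕ → ℕ → Prop) (f : ℕ → ℕ) (i y : ℕ) : Prop where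
  appr : ∀ v, i ≤ v → v < y → ¬ ap v p → ap v (f v)
  conn : ∀ c u v w, u < v → v < w → ap u c → ¬ Removed p ap f i y c u → ap w c →
    ¬ Removed p ap f i y c w → ap v c ∧ ¬ Removed p ap f i y c v

open scoped Classical in
/-- The cost of a plan. -/
noncomputable def planCost (p : ℕ) (ap : ℕ → ℕ → Prop) (pr : ℕ → ℕ → ℕ) (f : ℕ → ℕ) (i y : ℕ) : ℕ :=
  ∑ v ∈ Ico i y, if ap v p then 0 else pr v (f v)

open scoped Classical in
/-- The number of approvals that a candidate loses. -/
noncomputable def loss (p : ℕ) (ap : ℕ → ℕ → Prop) (f : ℕ → ℕ) (i y c : ℕ) : ℕ :=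
  ∑ v ∈ Ico i y, if ¬ ap v p ∧ f v = c then 1 else 0

open scoped Classical in
/-- The number of candidates whose score sinks from above `s` to at most `s`. -/
noncomputable def neut (N p : ℕ) (ap : ℕ → ℕ → Prop) (s : ℕ) (f : ℕ → ℕ) (i y : ℕ) : ℕ :=
  ∑ c ∈ range N,
    if s < apScore N ap c ∧ apScore N ap c ≤ s + loss p ap f i y c then 1 else 0

/-- Every candidate is approved by an interval of voters. -/
def IntervalApprovals (ap : ℕ → ℕ → Prop) : Prop :=
  ∀ c u v w, u < v → v < w → ap u c → ap w c → ap v c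

/-! ### The recurrence for the cheapest plans -/

section

variable {N p B : ℕ} {ap : ℕ → ℕ → Prop} {pr : ℕ → ℕ → ℕ} {i s x y c : ℕ} {f g : ℕ → ℕ}

theorem planCost_congr (h : ∀ v, i ≤ v → v < x → f v = g v) :
    planCost p ap pr f i x = planCost p ap pr g i x :=
  sum_congr rfl fun v hv => by
    rw [mem_Ico] at hv
    rw [h v hv.1 hv.2]

theorem loss_congr (h : ∀ v, i ≤ v → v < x → f v = g v) :
    loss p ap f i x c = loss p ap g i x c :=
  sum_congr rfl fun v hv => by
    rw [mem_Ico] at hv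
    rw [h v hv.1 hv.2]

theorem neut_congr (h : ∀ v, i ≤ v → v < x → f v = g v) :
    neut N p ap s f i x = neut N p ap s g i x :=
  sum_congr rfl fun c _ => by rw [loss_congr h]

theorem removed_congr (h : ∀ v, i ≤ v → v < x → f v = g v) (v : ℕ) :
    Removed p ap f i x c v ↔ Removed p ap g i x c v := by
  unfold Removed
  constructor <;> rintro ⟨h1, h2, h3, h4⟩ <;> have := h v h1 h2 <;> refine ⟨h1, h2, h3, ?_⟩ <;>
    omega

theorem IsPlan.congr (hg : IsPlan p ap g i x) (h : ∀ v, i ≤ v → v < x → f v = g v) :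
    IsPlan p ap f i x := by
  refine ⟨fun v h1 h2 h3 => ?_, fun c u v w => ?_⟩
  · rw [h v h1 h2]
    exact hg.appr v h1 h2 h3
  · simp only [removed_congr h]
    exact hg.conn c u v w

theorem removed_succ (hp : ap y p) (v : ℕ) :
    Removed p ap f i (y + 1) c v ↔ Removed p ap f i y c v := by
  unfold Removed
  refine ⟨fun ⟨h1, h2, h3, h4⟩ => ⟨h1, ?_, h3, h4⟩, fun ⟨h1, h2, h3, h4⟩ => ⟨h1, by omega, h3, h4⟩⟩
  rcases Nat.lt_succ_iff_lt_or_eq.1 h2 with h | rfl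
  · exact h
  · exact absurd hp h3

theorem isPlan_succ (hp : ap y p) : IsPlan p ap f i (y + 1) ↔ IsPlan p ap f i y := by
  refine ⟨fun h => ⟨fun v h1 h2 h3 => h.appr v h1 (by omega) h3, fun c u v w => ?_⟩,
    fun h => ⟨fun v h1 h2 h3 => ?_, fun c u v w => ?_⟩⟩
  · simpa only [removed_succ hp] using h.conn c u v w
  · rcases Nat.lt_succ_iff_lt_or_eq.1 h2 with h' | rfl
    · exact h.appr v h1 h' h3
    · exact absurd hp h3
  · simpa only [removed_succ hp] using h.conn c u v w

theorem planCost_succ (hi : i ≤ y) (hp : ap y p) :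
    planCost p ap pr f i (y + 1) = planCost p ap pr f i y := by
  simp [planCost, sum_Ico_succ_top hi, hp]

theorem neut_succ (hi : i ≤ y) (hp : ap y p) :
    neut N p ap s f i (y + 1) = neut N p ap s f i y := by
  simp [neut, loss, sum_Ico_succ_top hi, hp]

theorem apScore_le (h : ∀ v, ap v c → x ≤ v ∧ v < y) : apScore N ap c ≤ y - x := by
  classical
  rw [apScore, ← card_filter, ← Nat.card_Ico]
  exact card_le_card fun v hv => by
    rw [mem_Ico]
    exact h v (mem_filter.1 hv).2

/-- A candidate with more approvals than fit into the target interval loses approvals at most at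
one end. -/
theorem loss_eq_zero (hap : IntervalApprovals ap) (hyN : y ≤ N) (hys : y ≤ i + s)
    (hf : IsPlan p ap f i x) (hseg : IsSegment N p ap i x y c) (hc : s < apScore N ap c) :
    loss p ap f i x c = 0 := by
  obtain ⟨hix, hxy, hin, hend⟩ := hseg
  have hx := (hin x (by omega) le_rfl hxy).1
  refine sum_eq_zero fun v hv => if_neg ?_
  rw [mem_Ico] at hv
  rintro ⟨hvp, rfl⟩
  have hv' := hf.appr v hv.1 hv.2 hvp
  rcases hend with hend | hend
  -- If the segment opens the approval interval of the candidate, no voter `v < x` approves it, so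
  -- none can have given it up.
  · refine hend.elim (by omega) fun h => h ?_
    rcases eq_or_ne v (x - 1) with h1 | h1
    · rwa [← h1]
    · exact hap _ v (x - 1) x (by omega) (by omega) hv' hx
  · by_cases hu : ∃ u < i, ap u (f v)
    · obtain ⟨u, hui, hu⟩ := hu
      refine (hf.conn (f v) u v x (by omega) hv.2 hu (fun h => ?_) hx (fun h => ?_)).2
        ⟨hv.1, hv.2, hvp, rfl⟩
      · have := h.1
        omega
      · have := h.2.1
        omega
    · push Not at hu
      -- All approvers now lie in `i, …, y - 1`, so by `hys` there are at most `s` of them.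
      have := apScore_le (N := N) (ap := ap) (c := f v) (x := i) (y := y) fun u hu' => by
        refine ⟨not_lt.1 fun h => hu u h hu', not_le.1 fun h => hend ?_⟩
        rcases h.eq_or_lt with rfl | h
        · exact hu'
        · exact hap _ v y u (by omega) h hv' hu'
      omega

theorem planCost_segment (hyN : y ≤ N) (hseg : IsSegment N p ap i x y c)
    (hfc : ∀ v, x ≤ v → v < y → f v = c) :
    planCost p ap pr f i y = planCost p ap pr f i x + segCost N pr x y c := by
  obtain ⟨hix, hxy, hin, hend⟩ := hseg
  rw [planCost, planCost, segCost, ← sum_Ico_consecutive _ hix hxy.le, ← sum_filter]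
  congr 1
  rw [show (range N).filter (fun v => x ≤ v ∧ v < y) = Ico x y by ext v; simp; omega]
  refine sum_congr rfl fun v hv => ?_
  rw [mem_Ico] at hv
  rw [if_neg (hin v (by omega) hv.1 hv.2).2, hfc v hv.1 hv.2]

theorem loss_segment (hyN : y ≤ N) (hseg : IsSegment N p ap i x y c)
    (hfc : ∀ v, x ≤ v → v < y → f v = c) (d : ℕ) :
    loss p ap f i y d = loss p ap f i x d + if d = c then y - x else 0 := by
  obtain ⟨hix, hxy, hin, hend⟩ := hseg
  rw [loss, loss, ← sum_Ico_consecutive _ hix hxy.le]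
  congr 1
  rw [sum_congr rfl (g := fun _ => if d = c then 1 else 0)]
  · split_ifs <;> simp
  · intro v hv
    rw [mem_Ico] at hv
    simp [(hin v (by omega) hv.1 hv.2).2, hfc v hv.1 hv.2, eq_comm]

/-- A candidate `c` with score above `s` has lost nothing before by `loss_eq_zero`, so the length of
this segment alone decides whether it sinks to `s`. A candidate with score at most `s` never counts.
This is why a single counter suffices as the state of the dynamic program. -/
theorem neut_segment (hN : ∀ v c, ap v c → v < N ∧ c < N) (hap : IntervalApprovals ap)
    (hyN : y ≤ N) (hys : y ≤ i + s) (hf : IsPlan p ap f i x) (hseg : IsSegment N p ap i x y c)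
    (hfc : ∀ v, x ≤ v → v < y → f v = c) :
    neut N p ap s f i y = neut N p ap s f i x + gain N ap s x y c := by
  have hc : c < N := (hN x c (hseg.2.2.1 x (by have := hseg.2.1; omega) le_rfl hseg.2.1).1).2
  have : gain N ap s x y c = ∑ d ∈ range N, if d = c then gain N ap s x y c else 0 := by
    simp [hc]
  rw [neut, neut, this, ← sum_add_distrib]
  refine sum_congr rfl fun d _ => ?_
  rw [loss_segment hyN hseg hfc]
  by_cases hd : d = c
  · subst hd
    by_cases hs : s < apScore N ap d
    · rw [loss_eq_zero hap hyN hys hf hseg hs]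
      simp [gain, hs]
    · simp [gain, hs]
  · simp [hd]

/-- Remaining approvers `u` and `w` of `c` around a newly removed one would lie on both sides of the
segment, although the segment is at an end of the approval interval of `c`. -/
theorem IsPlan.extend (hap : IntervalApprovals ap) (hyN : y ≤ N)
    (hf : IsPlan p ap f i x) (hseg : IsSegment N p ap i x y c)
    (hfc : ∀ v, x ≤ v → v < y → f v = c) : IsPlan p ap f i y := by
  obtain ⟨hix, hxy, hin, hend⟩ := hseg
  have hrem : ∀ d v, Removed p ap f i y d v ↔ Removed p ap f i x d v ∨ d = c ∧ x ≤ v ∧ v < y := by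
    intro d v
    constructor
    · rintro ⟨h1, h2, h3, h4⟩
      by_cases hv : v < x
      · exact .inl ⟨h1, hv, h3, h4⟩
      · exact .inr ⟨h4.symm.trans (hfc v (by omega) h2), by omega, h2⟩
    · rintro (⟨h1, h2, h3, h4⟩ | ⟨rfl, h1, h2⟩)
      · exact ⟨h1, by omega, h3, h4⟩
      · exact ⟨by omega, h2, (hin v (by omega) h1 h2).2, hfc v h1 h2⟩
  have hx := (hin x (by omega) le_rfl hxy).1
  refine ⟨fun v h1 h2 h3 => ?_, fun d u v w huv hvw hu hu' hw hw' => ?_⟩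
  · by_cases hv : v < x
    · exact hf.appr v h1 hv h3
    · rw [hfc v (by omega) h2]
      exact (hin v (by omega) (by omega) h2).1
  · have hv := hap d u v w huv hvw hu hw
    refine ⟨hv, fun h => ?_⟩
    rw [hrem] at hu' hw' h
    push Not at hu' hw'
    rcases h with h | ⟨rfl, h1, h2⟩
    · exact (hf.conn d u v w huv hvw hu hu'.1 hw hw'.1).2 h
    · have hux : u < x := by
        by_contra hux
        have := hu'.2 rfl (by omega)
        omega
      have hyw : y ≤ w := hw'.2 rfl (by omega)
      rcases hend with (rfl | hend) | hend
      · omega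
      · refine hend ?_
        rcases eq_or_ne u (x - 1) with h1 | h1
        · rwa [← h1]
        · exact hap _ u (x - 1) x (by omega) (by omega) hu hx
      · refine hend ?_
        rcases hyw.eq_or_lt with rfl | hyw
        · exact hw
        · exact hap _ v y w h2 hyw hv hw

/-- The last run of a plan is a segment. -/
theorem IsPlan.exists_segment (hap : IntervalApprovals ap)
    (hf : IsPlan p ap f i y) (hiy : i < y) (hp : ¬ ap (y - 1) p) :
    ∃ x c, IsSegment N p ap i x y c ∧ (∀ v, x ≤ v → v < y → f v = c) ∧ IsPlan p ap f i x := by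
  classical
  set c := f (y - 1) with hc
  have hex : ∃ x, x < y ∧ ∀ v, x ≤ v → v < y → Removed p ap f i y c v := by
    refine ⟨y - 1, by omega, fun v h1 h2 => ?_⟩
    obtain rfl : v = y - 1 := by omega
    exact ⟨by omega, h2, hp, rfl⟩
  -- The leftmost start of the run ending in `y - 1`; by minimality the voter `x - 1` is not removed
  -- from `c`.
  obtain ⟨x, ⟨hxy, hrun⟩, hmin⟩ : ∃ x, (x < y ∧ ∀ v, x ≤ v → v < y → Removed p ap f i y c v) ∧
      (x ≠ 0 → ¬ Removed p ap f i y c (x - 1)) := by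
    refine ⟨Nat.find hex, Nat.find_spec hex, fun h0 h => ?_⟩
    have hs := Nat.find_spec hex
    refine Nat.find_min hex (m := Nat.find hex - 1) (by omega) ⟨by omega, fun v h1 h2 => ?_⟩
    by_cases hv : v = Nat.find hex - 1
    · rwa [hv]
    · exact hs.2 v (by omega) h2
  have hix : i ≤ x := (hrun x le_rfl hxy).1
  have happ : ∀ v, Removed p ap f i y c v → ap v c := by
    rintro v ⟨h1, h2, h3, h4⟩
    rw [← h4]
    exact hf.appr v h1 h2 h3
  refine ⟨x, c, ⟨hix, hxy, fun v _ h1 h2 => ⟨happ v (hrun v h1 h2), (hrun v h1 h2).2.2.1⟩, ?_⟩,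
    fun v h1 h2 => (hrun v h1 h2).2.2.2, fun v h1 h2 h3 => hf.appr v h1 (by omega) h3, ?_⟩
  -- Were `c` approved at both `x - 1` and `y`, both approvals would survive the plan around the
  -- removed one of `x`.
  · by_contra! h
    obtain ⟨⟨h0, h1⟩, h2⟩ := h
    exact (hf.conn c (x - 1) x y (by omega) hxy h1 (hmin h0) h2 fun h => absurd h.2.1 (by omega)).2
      (hrun x le_rfl hxy)
  · intro d u v w huv hvw hu hu' hw hw'
    have hv := hap d u v w huv hvw hu hw
    refine ⟨hv, fun h => ?_⟩
    have hlift : ∀ v, Removed p ap f i x d v → Removed p ap f i y d v := fun v h =>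
      ⟨h.1, by have := h.2.1; omega, h.2.2.1, h.2.2.2⟩
    have hvx := h.2.1
    have huy : ¬ Removed p ap f i y d u := fun h' => hu' ⟨h'.1, by omega, h'.2.2.1, h'.2.2.2⟩
    -- Cutting off the last run could only do harm if it restores the approval of `w`. Then `d = c`,
    -- and `x - 1` takes over the role of `w` in the original plan.
    by_cases hwy : Removed p ap f i y d w
    · have hxw : x ≤ w := by
        by_contra hxw
        exact hw' ⟨hwy.1, by omega, hwy.2.2.1, hwy.2.2.2⟩
      obtain rfl : d = c := hwy.2.2.2.symm.trans (hrun w hxw hwy.2.1).2.2.2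
      have hx1 := hmin (by omega)
      have hne : v ≠ x - 1 := fun h1 => hx1 (h1 ▸ hlift v h)
      exact (hf.conn _ u v (x - 1) huv (by omega) hu huy
        (hap _ v (x - 1) w (by omega) (by omega) hv hw) hx1).2 (hlift v h)
    · exact (hf.conn d u v w huv hvw hu huy hw hwy).2 (hlift v h)

/-- The meaning of a table entry. -/
def IsOptimum (N p B : ℕ) (ap : ℕ → ℕ → Prop) (pr : ℕ → ℕ → ℕ) (i s y q val : ℕ) : Prop :=
  ∀ W ≤ B, val ≤ W ↔ ∃ f, IsPlan p ap f i y ∧ planCost p ap pr f i y ≤ W ∧ neut N p ap s f i y = q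

/-- Every nonempty plan ends in a voter approving `p` or in a segment, matching the cases of the
recurrence. All thresholds `W ≤ B` are needed because the cost of a segment is subtracted from `W`;
the value `B + 1` meets none of them and so marks a missing plan. -/
theorem isOptimum_tableStep (hN : ∀ v c, ap v c → v < N ∧ c < N) (hap : IntervalApprovals ap)
    (hyN : y ≤ N) (hiy : i ≤ y) (hys : y ≤ i + s) {q : ℕ} {tbl : ℕ → ℕ → ℕ}
    (htbl : ∀ x r, i ≤ x → x < y → r ≤ q → IsOptimum N p B ap pr i s x r (tbl x r)) :
    IsOptimum N p B ap pr i s y q (tableStep N p B ap pr i s tbl y q) := by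
  classical
  intro W hW
  simp only [tableStep, minBelow_le_iff]
  constructor
  · rintro (h | ⟨x, hx, h | ⟨c, hc, h⟩⟩)
    · split_ifs at h with h1 h2
      · obtain ⟨rfl, rfl⟩ := h1
        refine ⟨fun _ => 0, ⟨fun v h1 h2 => by omega, fun c u v w huv hvw hu hu' hw hw' => ?_⟩, ?_, ?_⟩
        · exact ⟨hap c u v w huv hvw hu hw, fun h => by have := h.1; have := h.2.1; omega⟩
        · simp [planCost]
        · simp only [neut, loss]
          refine sum_eq_zero fun c _ => if_neg ?_
          simp
      · obtain ⟨y, rfl⟩ : ∃ z, y = z + 1 := ⟨y - 1, by omega⟩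
        rw [Nat.add_sub_cancel] at h h2
        obtain ⟨f, h3, h4, h5⟩ := (htbl y q (by omega) (by omega) le_rfl W hW).1 h
        exact ⟨f, (isPlan_succ h2.2).2 h3, by rwa [planCost_succ (by omega) h2.2],
          by rwa [neut_succ (by omega) h2.2]⟩
      · omega
    · omega
    · split_ifs at h with h1
      · obtain ⟨hseg, hg⟩ := h1
        obtain ⟨g, h3, h4, h5⟩ := (htbl x (q - gain N ap s x y c) hseg.1 hseg.2.1 (by omega)
          (W - segCost N pr x y c) (by omega)).1 (by omega)
        have hfg : ∀ v, i ≤ v → v < x → (fun v => if v < x then g v else c) v = g v :=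
          fun v _ hv => if_pos hv
        have hfc : ∀ v, x ≤ v → v < y → (fun v => if v < x then g v else c) v = c :=
          fun v hv _ => if_neg (by omega)
        have h3' := h3.congr hfg
        refine ⟨_, h3'.extend hap hyN hseg hfc, ?_, ?_⟩
        · rw [planCost_segment hyN hseg hfc, planCost_congr hfg]
          omega
        · rw [neut_segment hN hap hyN hys h3' hseg hfc, neut_congr hfg]
          omega
      · omega
  · rintro ⟨f, hf, hcost, hq⟩
    rcases hiy.eq_or_lt with rfl | hiy
    · left
      rw [if_pos]
      · omega
      · refine ⟨rfl, ?_⟩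
        rw [← hq]
        simp only [neut, loss]
        refine sum_eq_zero fun c _ => if_neg ?_
        simp
    by_cases hp : ap (y - 1) p
    · left
      rw [if_neg (by omega), if_pos ⟨hiy, hp⟩]
      obtain ⟨y, rfl⟩ : ∃ z, y = z + 1 := ⟨y - 1, by omega⟩
      rw [Nat.add_sub_cancel] at hp ⊢
      rw [planCost_succ (by omega) hp] at hcost
      rw [neut_succ (by omega) hp] at hq
      exact (htbl y q (by omega) (by omega) le_rfl W hW).2 ⟨f, (isPlan_succ hp).1 hf, hcost, hq⟩
    · right
      obtain ⟨x, c, hseg, hfc, hfx⟩ := hf.exists_segment (N := N) hap hiy hp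
      have hxy := hseg.2.1
      have hxc := hN x c (hseg.2.2.1 x (by omega) le_rfl hxy).1
      refine ⟨x, hxc.1, .inr ⟨c, hxc.2, ?_⟩⟩
      rw [planCost_segment hyN hseg hfc] at hcost
      rw [neut_segment hN hap hyN hys hfx hseg hfc] at hq
      rw [if_pos ⟨hseg, by omega⟩]
      have := (htbl x (q - gain N ap s x y c) hseg.1 hxy (by omega)
        (W - segCost N pr x y c) (by omega)).2 ⟨f, hfx, by omega, by omega⟩
      omega

open scoped Classical in
/-- The number of candidates with score above `s`. -/
noncomputable def numAbove (N : ℕ) (ap : ℕ → ℕ → Prop) (s : ℕ) : ℕ :=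
  ∑ c ∈ range N, if s < apScore N ap c then 1 else 0

open scoped Classical in
/-- The number of candidates with score above `s` after a plan. -/
noncomputable def numAboveAfter (N p : ℕ) (ap : ℕ → ℕ → Prop) (s : ℕ) (f : ℕ → ℕ) (i y : ℕ) : ℕ :=
  ∑ c ∈ range N, if s + loss p ap f i y c < apScore N ap c then 1 else 0

/-- A candidate that starts above `s` either sinks or stays above. So the winning condition depends
on the plan only through the counter `q`. -/
theorem neut_add_numAboveAfter :
    neut N p ap s f i y + numAboveAfter N p ap s f i y = numAbove N ap s := by
  rw [neut, numAboveAfter, numAbove, ← sum_add_distrib]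
  refine sum_congr rfl fun c _ => ?_
  split_ifs <;> omega

/-- The index `N - 1` has no approvals, so at most `N - 1` candidates can sink and a table row of
`N` entries has room for every counter. -/
theorem numAbove_lt (hN : ∀ v c, ap v c → v < N ∧ c + 1 < N) (h0 : 0 < N) : numAbove N ap s < N := by
  classical
  obtain ⟨N, rfl⟩ : ∃ M, N = M + 1 := ⟨N - 1, by omega⟩
  rw [numAbove, sum_range_succ, if_neg, add_zero]
  · refine (sum_le_sum (g := fun _ => 1) fun c _ => by split_ifs <;> omega).trans_lt ?_
    simp
  · rw [apScore, sum_eq_zero fun v _ => if_neg fun h => ?_]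
    · omega
    · have := hN _ _ h
      omega

theorem exists_isOptimum_iff (hN : ∀ v c, ap v c → v < N ∧ c + 1 < N) (h0 : 0 < N)
    {k : ℕ} {tbl : ℕ → ℕ} (htbl : ∀ q < N, IsOptimum N p B ap pr i s y q (tbl q)) :
    (∃ q < N, tbl q ≤ B ∧ numAbove N ap s < q + k) ↔
      ∃ f, IsPlan p ap f i y ∧ planCost p ap pr f i y ≤ B ∧ numAboveAfter N p ap s f i y < k := by
  constructor
  · rintro ⟨q, hq, h1, h2⟩
    obtain ⟨f, h3, h4, h5⟩ := (htbl q hq B le_rfl).1 h1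
    refine ⟨f, h3, h4, ?_⟩
    rw [← neut_add_numAboveAfter (p := p) (f := f) (i := i) (y := y), h5] at h2
    omega
  · rintro ⟨f, h3, h4, h5⟩
    have h6 := neut_add_numAboveAfter (N := N) (p := p) (ap := ap) (s := s) (f := f) (i := i) (y := y)
    have h7 := numAbove_lt (s := s) hN h0
    exact ⟨neut N p ap s f i y, by omega, (htbl _ (by omega) B le_rfl).2 ⟨f, h3, h4, rfl⟩, by omega⟩

end

/-! ### Winning committees -/

section Committee

variable {V C : Type} [Fintype V] [DecidableEq C]

theorem Election.committeeScore_exchange (E : Election V C) {S : Finset C} {c d : C} (hc : c ∈ S)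
    (hd : d ∉ S) : E.committeeScore (insert d (S.erase c)) + E.score c =
      E.committeeScore S + E.score d := by
  rw [committeeScore, committeeScore, sum_insert (by simp [hd]), ← add_sum_erase S _ hc]
  ring

/-- A candidate belongs to a winning committee of size `k` exactly if fewer than `k` candidates
have a higher score. -/
theorem Election.exists_isWinningCommittee_iff [Fintype C] (E : Election V C) {k : ℕ} (hk : 1 ≤ k)
    (hkC : k ≤ Fintype.card C) (p : C) :
    (∃ S, E.IsWinningCommittee k S ∧ p ∈ S) ↔ #{c | E.score p < E.score c} < k := by
  constructor
  · rintro ⟨S, ⟨hS, hmax⟩, hp⟩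
    by_contra! hcard
    -- The set `S.erase p` has only `k - 1` members, so it misses some better candidate; exchanging
    -- `p` for it would improve `S`.
    obtain ⟨c, hc, hcS⟩ : ∃ c ∈ ({c | E.score p < E.score c} : Finset C), c ∉ S.erase p := by
      refine exists_mem_notMem_of_card_lt_card ?_
      rw [card_erase_of_mem hp]
      omega
    rw [mem_filter] at hc
    have hcS' : c ∉ S := fun h => hcS (mem_erase.2 ⟨fun h' => by simp [h'] at hc, h⟩)
    have h1 := E.committeeScore_exchange hp hcS'
    have h2 := hmax (insert c (S.erase p)) (by
      rw [card_insert_of_notMem hcS, card_erase_of_mem hp]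
      omega)
    have := hc.2
    omega
  · intro hcard
    obtain ⟨S, hS, hmax⟩ := exists_max_image (powersetCard k (univ : Finset C)) E.committeeScore
      (powersetCard_nonempty.2 (by simpa using hkC))
    simp only [mem_powersetCard, subset_univ, true_and] at hS hmax
    by_cases hp : p ∈ S
    · exact ⟨S, ⟨hS, hmax⟩, hp⟩
    -- An optimal committee without `p` has a member that does not beat `p`, and exchanging it for
    -- `p` loses nothing.
    obtain ⟨c, hc, hcp⟩ := exists_mem_notMem_of_card_lt_card (hcard.trans_eq hS.symm)
    simp only [mem_filter, mem_univ, true_and, not_lt] at hcp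
    have h1 := E.committeeScore_exchange hc hp
    refine ⟨insert p (S.erase c), ⟨?_, fun T hT => ?_⟩, mem_insert_self _ _⟩
    · rw [card_insert_of_notMem (by simp [hp]), card_erase_of_mem hc]
      omega
    · have := hmax T hT
      omega

end Committee

/-! ### The effect of a bribery -/

section Bribe

variable {V C : Type} [DecidableEq V] [DecidableEq C]

/-- The ballots after the voters `v` with `ch v = some c` moved their approval of `c` to `p`. -/
def bribed (E : Election V C) (p : C) (ch : V → Option C) : Election V C := fun v =>
  (ch v).elim (E v) fun c => insert p ((E v).erase c)

/-- The unit operations are possible. -/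
def IsChoice (E : Election V C) (p : C) (ch : V → Option C) : Prop :=
  ∀ v c, ch v = some c → c ∈ E v ∧ p ∉ E v

/-- An operation makes its voter approve `p`, so no voter is bribed twice and the order is
irrelevant: a sequence of operations amounts to a partial choice of one candidate per voter. -/
theorem bribeToP_iff [Fintype V] {price : V → C → ℕ∞} {p : C} {E E' : Election V C} {w : ℕ∞} :
    BribeToP price p E E' w ↔ ∃ ch, IsChoice E p ch ∧ E' = bribed E p ch ∧
      w = ∑ v, (ch v).elim 0 (price v) := by
  constructor
  · intro h
    induction h with
    | refl => exact ⟨fun _ => none, by simp [IsChoice], rfl, by simp⟩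
    | @step E' w v c h hc hp ih =>
      obtain ⟨ch, h1, rfl, rfl⟩ := ih
      have hv : ch v = none := by
        rcases hch : ch v with _ | d
        · rfl
        · simp [bribed, hch] at hp
      simp only [bribed, hv, Option.elim_none] at hc hp
      refine ⟨Function.update ch v (some c), fun u d hd => ?_, ?_, ?_⟩
      · by_cases hu : u = v
        · subst hu
          rw [Function.update_self, Option.some_inj] at hd
          exact hd ▸ ⟨hc, hp⟩
        · rw [Function.update_of_ne hu] at hd
          exact h1 u d hd
      · funext u
        by_cases hu : u = v
        · subst hu
          simp [Election.swap, bribed, hv]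
        · simp [Election.swap, bribed, hu]
      · rw [← add_sum_erase _ _ (mem_univ v), ← add_sum_erase _ _ (mem_univ v), hv,
          Function.update_self, add_comm]
        simp only [Option.elim_none, Option.elim_some, zero_add]
        congr 1
        refine sum_congr rfl fun u hu => ?_
        rw [Function.update_of_ne (ne_of_mem_erase hu)]
  · rintro ⟨ch, h1, rfl, rfl⟩
    suffices H : ∀ T : Finset V, BribeToP price p E
        (bribed E p fun v => if v ∈ T then ch v else none) (∑ v ∈ T, (ch v).elim 0 (price v)) by
      simpa using H univ
    intro T
    induction T using Finset.induction_on with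
    | empty =>
      exact BribeToP.refl (price := price) (p := p) E
    | insert v T hv ih =>
      rw [sum_insert hv]
      rcases hch : ch v with _ | c
      · convert ih using 2
        · funext u
          by_cases hu : u = v
          · simp [hu, hch]
          · simp [hu]
        · simp
      · have hc := h1 v c hch
        convert ih.step v c (by simpa [bribed, hv] using hc.1) (by simpa [bribed, hv] using hc.2)
          using 1
        · funext u
          by_cases hu : u = v
          · simp [hu, hch, bribed, Election.swap, hv]
          · simp [hu, bribed, Election.swap]
        · simp [add_comm]

end Bribe

theorem exists_eq_Ico {n : ℕ} {S : Set (Fin n)} (hS : S.OrdConnected) :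
    ∃ i e, i ≤ e ∧ e ≤ n ∧ ∀ v : Fin n, v ∈ S ↔ i ≤ v ∧ (v : ℕ) < e := by
  classical
  rcases S.eq_empty_or_nonempty with rfl | hne
  · exact ⟨0, 0, le_rfl, by omega, by simp⟩
  · have hne' : S.toFinset.Nonempty := by simpa using hne
    have hmin : S.toFinset.min' hne' ∈ S := Set.mem_toFinset.1 (min'_mem _ _)
    have hmax : S.toFinset.max' hne' ∈ S := Set.mem_toFinset.1 (max'_mem _ _)
    refine ⟨S.toFinset.min' hne', S.toFinset.max' hne' + 1, ?_, ?_, fun v => ⟨fun hv => ?_, ?_⟩⟩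
    · have := min'_le_max' _ hne'
      rw [Fin.le_def] at this
      omega
    · have := (S.toFinset.max' hne').2
      omega
    · have h1 := min'_le _ v (Set.mem_toFinset.2 hv)
      have h2 := le_max' _ v (Set.mem_toFinset.2 hv)
      rw [Fin.le_def] at h1 h2
      omega
    · rintro ⟨h1, h2⟩
      exact hS.out hmin hmax ⟨h1, by rw [Fin.le_def]; omega⟩

/-- The numeric value of a price, where infinity is replaced by a number above the budget. -/
def cappedPrice (B : ℕ) (w : ℕ∞) : ℕ :=
  if encodePrice w = 0 then B + 1 else encodePrice w - 1

theorem cappedPrice_top (B : ℕ) : cappedPrice B ⊤ = B + 1 := rfl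

theorem cappedPrice_coe (B a : ℕ) : cappedPrice B a = a := rfl

/-- One infinite price breaks the budget on either side, since its cap `B + 1` alone exceeds `B`;
without one, the two sums agree. -/
theorem sum_le_iff_sum_cappedPrice_le {ι : Type} (S : Finset ι) (x : ι → ℕ∞) (B : ℕ) :
    ∑ v ∈ S, x v ≤ B ↔ ∑ v ∈ S, cappedPrice B (x v) ≤ B := by
  by_cases h : ∃ v ∈ S, x v = ⊤
  · obtain ⟨v, hv, hx⟩ := h
    have h1 := single_le_sum (f := x) (fun _ _ => zero_le) hv
    have h2 := single_le_sum (f := fun v => cappedPrice B (x v)) (fun _ _ => Nat.zero_le _) hv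
    rw [hx, top_le_iff] at h1
    simp only [hx, cappedPrice_top] at h2
    rw [h1]
    simp
    omega
  · push Not at h
    have : ∀ v ∈ S, x v = (cappedPrice B (x v) : ℕ) := by
      intro v hv
      obtain ⟨a, ha⟩ := ENat.ne_top_iff_exists.1 (h v hv)
      rw [← ha, cappedPrice_coe]
    rw [sum_congr rfl this]
    norm_cast

/-! ### Solvability in terms of plans -/

section Solvable

variable {I : BriberyInstance} {N : ℕ} {ap : ℕ → ℕ → Prop} {pr : ℕ → ℕ → ℕ}

theorem sum_range_eq_sum_fin {n N : ℕ} (h : n ≤ N) {g : ℕ → ℕ} (hg : ∀ v, n ≤ v → g v = 0) :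
    ∑ v ∈ range N, g v = ∑ v : Fin n, g v := by
  rw [Fin.sum_univ_eq_sum_range g n]
  exact (sum_subset (range_subset_range.2 h) fun v _ hv => hg v (by simpa using hv)).symm

theorem sum_Ico_eq_sum_fin {n i e : ℕ} (h : e ≤ n) (g : ℕ → ℕ) :
    ∑ v ∈ Ico i e, g v = ∑ v : Fin n, if i ≤ v ∧ (v : ℕ) < e then g v else 0 := by
  rw [Fin.sum_univ_eq_sum_range (fun v => if i ≤ v ∧ v < e then g v else 0) n, ← sum_filter]
  congr 1
  ext v
  simp
  omega

/-- The function `ap` describes the approvals of an instance. -/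
def Describes (I : BriberyInstance) (ap : ℕ → ℕ → Prop) : Prop :=
  ∀ v c, ap v c ↔ ∃ (hv : v < I.n) (hc : c < I.m), (⟨c, hc⟩ : Fin I.m) ∈ I.election ⟨v, hv⟩

theorem Describes.iff (h : Describes I ap) (v : Fin I.n) (c : Fin I.m) :
    ap v c ↔ c ∈ I.election v := by
  simp [h v c]

theorem Describes.lt (h : Describes I ap) {v c : ℕ} (hvc : ap v c) : v < I.n ∧ c < I.m := by
  obtain ⟨hv, hc, -⟩ := (h v c).1 hvc
  exact ⟨hv, hc⟩

theorem Describes.intervalApprovals (h : Describes I ap) :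
    I.election.IsVoterInterval ↔ IntervalApprovals ap := by
  constructor
  · intro hI c u v w huv hvw hu hw
    have h1 := h.lt hu
    have h2 := h.lt hw
    have := (hI ⟨c, h1.2⟩).out (x := ⟨u, h1.1⟩) (y := ⟨w, h2.1⟩)
      ((h.iff ⟨u, h1.1⟩ ⟨c, h1.2⟩).1 hu) ((h.iff ⟨w, h2.1⟩ ⟨c, h1.2⟩).1 hw)
      (show ⟨v, by omega⟩ ∈ _ from ⟨huv.le, hvw.le⟩)
    exact (h.iff ⟨v, by omega⟩ ⟨c, h1.2⟩).2 this
  · intro hI c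
    refine ⟨fun u hu w hw v hv => ?_⟩
    rcases hv.1.eq_or_lt with rfl | h1
    · exact hu
    rcases hv.2.eq_or_lt with rfl | h2
    · exact hw
    exact (h.iff v c).1 (hI c u v w h1 h2 ((h.iff u c).2 hu) ((h.iff w c).2 hw))

variable {i e : ℕ} {f : ℕ → ℕ} {E' : Election (Fin I.n) (Fin I.m)}

/-- `E'` results from the plan `f` for the voters `i, …, e - 1`. -/
structure Results (I : BriberyInstance) (ap : ℕ → ℕ → Prop) (f : ℕ → ℕ) (i e : ℕ)
    (E' : Election (Fin I.n) (Fin I.m)) : Prop where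
  le : i ≤ e
  le_n : e ≤ I.n
  pref : ∀ v, I.p ∈ E' v ↔ i ≤ v ∧ (v : ℕ) < e
  other : ∀ v c, c ≠ I.p → (c ∈ E' v ↔ ap v c ∧ ¬ Removed I.p ap f i e c v)
  appr : ∀ v, i ≤ v → v < e → ¬ ap v I.p → ap v (f v)
  subset : ∀ v, ap v I.p → i ≤ v ∧ v < e

theorem Results.isVoterInterval_iff (hd : Describes I ap) (hap : IntervalApprovals ap)
    (h : Results I ap f i e E') : E'.IsVoterInterval ↔ IsPlan I.p ap f i e := by
  constructor
  · refine fun hE => ⟨h.appr, fun c u v w huv hvw hu hu' hw hw' => ?_⟩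
    have h1 := hd.lt hu
    have h2 := hd.lt hw
    by_cases hc : c = I.p
    · subst hc
      -- The condition `conn` also covers `p` itself, but nobody can give up `p`: a removed voter
      -- approves `f v` and does not approve `p`.
      refine ⟨hap _ u v w huv hvw hu hw, fun hr => hr.2.2.1 ?_⟩
      conv_rhs => rw [← hr.2.2.2]
      exact h.appr v hr.1 hr.2.1 hr.2.2.1
    · have hc' : (⟨c, h1.2⟩ : Fin I.m) ≠ I.p := fun h' => hc (by rw [← h'])
      have := (hE ⟨c, h1.2⟩).out (x := ⟨u, h1.1⟩) (y := ⟨w, h2.1⟩)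
        ((h.other ⟨u, h1.1⟩ ⟨c, h1.2⟩ hc').2 ⟨hu, hu'⟩)
        ((h.other ⟨w, h2.1⟩ ⟨c, h1.2⟩ hc').2 ⟨hw, hw'⟩)
        (show ⟨v, by omega⟩ ∈ _ from ⟨huv.le, hvw.le⟩)
      exact (h.other ⟨v, by omega⟩ ⟨c, h1.2⟩ hc').1 this
  · intro hP c
    refine ⟨fun u hu w hw v hv => ?_⟩
    by_cases hc : c = I.p
    · subst hc
      simp only [Set.mem_ofPred_eq, h.pref] at hu hw ⊢
      have h1 : (u : ℕ) ≤ v := hv.1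
      have h2 : (v : ℕ) ≤ w := hv.2
      omega
    · rcases hv.1.eq_or_lt with rfl | h1
      · exact hu
      rcases hv.2.eq_or_lt with rfl | h2
      · exact hw
      simp only [Set.mem_ofPred_eq, h.other _ c hc] at hu hw ⊢
      exact hP.conn c u v w h1 h2 hu.1 hu.2 hw.1 hw.2

theorem Results.score_pref (h : Results I ap f i e E') : E'.score I.p = e - i := by
  classical
  have := sum_Ico_eq_sum_fin h.le_n (i := i) (fun _ => 1)
  rw [sum_const, Nat.card_Ico, smul_eq_mul, mul_one] at this
  rw [this, Election.score, card_filter]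
  exact sum_congr rfl fun v _ => by simp only [h.pref]

theorem Results.score_other (hd : Describes I ap) (hN : I.n ≤ N) (h : Results I ap f i e E')
    {c : Fin I.m} (hc : c ≠ I.p) : E'.score c + loss I.p ap f i e c = apScore N ap c := by
  classical
  rw [loss, sum_Ico_eq_sum_fin h.le_n, apScore, sum_range_eq_sum_fin hN, Election.score, card_filter,
    ← sum_add_distrib]
  · refine sum_congr rfl fun v _ => ?_
    have hr : Removed I.p ap f i e c v → ap v c := fun hr => by
      rw [← hr.2.2.2]
      exact h.appr v hr.1 hr.2.1 hr.2.2.1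
    simp only [h.other v c hc, ← ite_and]
    simp only [show ((i ≤ (v : ℕ) ∧ (v : ℕ) < e) ∧ ¬ ap v I.p ∧ f v = c) ↔
      Removed I.p ap f i e c v by unfold Removed; tauto]
    by_cases h1 : Removed I.p ap f i e c v
    · simp [h1, hr h1]
    · simp [h1]
  · exact fun v hv => if_neg fun h' => by
      have := hd.lt h'
      omega

/-- For `c = p` both sides are false, as the original approvers of `p` lie in the target interval.
Counting therefore need not exclude `p`. -/
theorem Results.lt_score_iff (hd : Describes I ap) (hN : I.n ≤ N) (h : Results I ap f i e E')
    (c : Fin I.m) :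
    E'.score I.p < E'.score c ↔ e - i + loss I.p ap f i e c < apScore N ap c := by
  by_cases hc : c = I.p
  · subst hc
    have := apScore_le (N := N) h.subset
    omega
  · have := h.score_other hd hN hc
    rw [h.score_pref]
    omega

theorem Results.exists_winning_iff (hd : Describes I ap) (hN : I.n ≤ N)
    (hN' : ∀ v c, ap v c → c < N) (h : Results I ap f i e E') :
    (∃ S, E'.IsWinningCommittee I.k S ∧ I.p ∈ S) ↔ numAboveAfter N I.p ap (e - i) f i e < I.k := by
  classical
  rw [Election.exists_isWinningCommittee_iff _ I.one_le_k (by simpa using I.k_le_m)]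
  have hpos : ∀ c, 0 < apScore N ap c → c < I.m ∧ c < N := by
    intro c hc
    obtain ⟨v, -, hv⟩ := exists_ne_zero_of_sum_ne_zero hc.ne'
    have hv : ap v c := by
      by_contra h'
      simp [h'] at hv
    exact ⟨(hd.lt hv).2, hN' v c hv⟩
  have : #{c | E'.score I.p < E'.score c} = numAboveAfter N I.p ap (e - i) f i e := by
    rw [numAboveAfter, ← card_filter]
    refine card_bij (fun c _ => (c : ℕ)) ?_ (fun a _ b _ hab => Fin.ext hab) ?_
    · intro c hc
      simp only [mem_filter, mem_univ, true_and, h.lt_score_iff hd hN, mem_range] at hc ⊢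
      exact ⟨(hpos c (by omega)).2, hc⟩
    · intro c hc
      simp only [mem_filter, mem_range] at hc
      refine ⟨⟨c, (hpos c (by omega)).1⟩, ?_, rfl⟩
      simpa only [mem_filter, mem_univ, true_and, h.lt_score_iff hd hN] using hc.2
  rw [this]

/-- The choice of approvals that a plan makes. -/
def IsChoiceOf (I : BriberyInstance) (ap : ℕ → ℕ → Prop) (f : ℕ → ℕ) (i e : ℕ)
    (ch : Fin I.n → Option (Fin I.m)) : Prop :=
  ∀ v c, ch v = some c ↔ Removed I.p ap f i e c v

variable {ch : Fin I.n → Option (Fin I.m)}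

theorem IsChoiceOf.results (hd : Describes I ap) (hie : i ≤ e) (he : e ≤ I.n)
    (hch : IsChoiceOf I ap f i e ch)
    (happr : ∀ v, i ≤ v → v < e → ¬ ap v I.p → ap v (f v))
    (hsub : ∀ v, ap v I.p → i ≤ v ∧ v < e) :
    Results I ap f i e (bribed I.election I.p ch) := by
  refine ⟨hie, he, fun v => ?_, fun v c hc => ?_, happr, hsub⟩
  · rcases hv : ch v with _ | d
    · simp only [bribed, hv, Option.elim_none, ← hd.iff]
      refine ⟨hsub v, fun h => ?_⟩
      by_contra hp
      have hf := happr v h.1 h.2 hp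
      have := (hch v ⟨f v, (hd.lt hf).2⟩).2 ⟨h.1, h.2, hp, rfl⟩
      simp [hv] at this
    · have := (hch v d).1 hv
      simp [bribed, hv, this.1, this.2.1]
  · rw [← hch v c, hd.iff]
    rcases hv : ch v with _ | d
    · simp [bribed, hv]
    · simp only [bribed, hv, Option.elim_some, mem_insert, hc, mem_erase, false_or,
        Option.some_inj]
      tauto

theorem IsChoiceOf.planCost_eq (hpr : ∀ (v : Fin I.n) (c : Fin I.m),
      pr v c = cappedPrice I.B (I.price v c)) (hd : Describes I ap) (he : e ≤ I.n)
    (hch : IsChoiceOf I ap f i e ch)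
    (happr : ∀ v, i ≤ v → v < e → ¬ ap v I.p → ap v (f v)) :
    planCost I.p ap pr f i e ≤ I.B ↔ ∑ v, (ch v).elim 0 (I.price v) ≤ I.B := by
  classical
  rw [sum_le_iff_sum_cappedPrice_le, planCost, sum_Ico_eq_sum_fin he]
  suffices H : ∀ v : Fin I.n, (if i ≤ (v : ℕ) ∧ (v : ℕ) < e then
      if ap v I.p then 0 else pr v (f v) else 0) = cappedPrice I.B ((ch v).elim 0 (I.price v)) by
    rw [sum_congr rfl fun v _ => H v]
  intro v
  rcases hv : ch v with _ | d
  · rw [Option.elim_none, show cappedPrice I.B 0 = 0 from rfl]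
    split_ifs with h1 h2
    · rfl
    · have hf := happr v h1.1 h1.2 h2
      have := (hch v ⟨f v, (hd.lt hf).2⟩).2 ⟨h1.1, h1.2, h2, rfl⟩
      simp [hv] at this
    · rfl
  · have h := (hch v d).1 hv
    rw [if_pos ⟨h.1, h.2.1⟩, if_neg h.2.2.1, h.2.2.2, hpr, Option.elim_some]

theorem solvable_iff (hd : Describes I ap) (hap : IntervalApprovals ap) (hN : I.n ≤ N)
    (hN' : ∀ v c, ap v c → c < N)
    (hpr : ∀ (v : Fin I.n) (c : Fin I.m), pr v c = cappedPrice I.B (I.price v c)) :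
    I.Solvable ↔ ∃ i e, i ≤ e ∧ e ≤ I.n ∧ (∀ v, ap v I.p → i ≤ v ∧ v < e) ∧
      ∃ f, IsPlan I.p ap f i e ∧ planCost I.p ap pr f i e ≤ I.B ∧
        numAboveAfter N I.p ap (e - i) f i e < I.k := by
  classical
  constructor
  · rintro ⟨E', w, hbr, hw, hVI, hwin⟩
    obtain ⟨ch, hch, rfl, rfl⟩ := bribeToP_iff.1 hbr
    obtain ⟨i, e, hie, he, hmem⟩ := exists_eq_Ico (hVI I.p)
    have hmem' : ∀ v : Fin I.n, (ap v I.p ∨ ∃ c, ch v = some c) ↔ i ≤ v ∧ (v : ℕ) < e := by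
      intro v
      rw [← hmem v, Set.mem_ofPred_eq, bribed, hd.iff]
      rcases hv : ch v with _ | c <;> simp
    -- The default `0` is immaterial: plans are consulted only at voters of the interval who did not
    -- approve `p`, and all of these were bribed.
    let f : ℕ → ℕ := fun v => if h : v < I.n then ((ch ⟨v, h⟩).elim 0 fun c => (c : ℕ)) else 0
    have hf : ∀ (v : Fin I.n) c, ch v = some c → f v = c := by
      intro v c hv
      simp [f, hv]
    have hsub : ∀ v, ap v I.p → i ≤ v ∧ v < e := fun v hv => by
      have := (hmem' ⟨v, (hd.lt hv).1⟩).1 (.inl hv)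
      exact this
    have hex : ∀ (v : Fin I.n), i ≤ v → v < e → ¬ ap v I.p → ∃ c, ch v = some c :=
      fun v h1 h2 h3 => ((hmem' v).2 ⟨h1, h2⟩).resolve_left h3
    have hchf : IsChoiceOf I ap f i e ch := by
      intro v c
      constructor
      · intro h
        have h1 := (hmem' v).1 (.inr ⟨c, h⟩)
        exact ⟨h1.1, h1.2, by rw [hd.iff]; exact (hch v c h).2, hf v c h⟩
      · rintro ⟨h1, h2, h3, h4⟩
        obtain ⟨d, h5⟩ := hex v h1 h2 h3
        rw [h5, Option.some_inj]
        exact Fin.ext (by rw [← h4, hf v d h5])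
    have happr : ∀ v, i ≤ v → v < e → ¬ ap v I.p → ap v (f v) := by
      intro v h1 h2 h3
      obtain ⟨c, hc⟩ := hex ⟨v, by omega⟩ h1 h2 h3
      have h4 := (hd.iff ⟨v, by omega⟩ c).2 (hch _ _ hc).1
      rw [← hf _ c hc] at h4
      exact h4
    have hres := hchf.results hd hie he happr hsub
    exact ⟨i, e, hie, he, hsub, f, (hres.isVoterInterval_iff hd hap).1 hVI,
      (hchf.planCost_eq hpr hd he happr).2 hw, (hres.exists_winning_iff hd hN hN').1 hwin⟩
  · rintro ⟨i, e, hie, he, hsub, f, hplan, hcost, hnum⟩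
    let ch : Fin I.n → Option (Fin I.m) := fun v =>
      if h : ∃ c : Fin I.m, Removed I.p ap f i e c v then some h.choose else none
    have hchf : IsChoiceOf I ap f i e ch := by
      intro v c
      constructor
      · intro h
        simp only [ch] at h
        split_ifs at h with h1
        rw [Option.some_inj] at h
        exact h ▸ h1.choose_spec
      · intro h
        have h1 : ∃ c : Fin I.m, Removed I.p ap f i e c v := ⟨c, h⟩
        simp only [ch, dif_pos h1, Option.some_inj]
        exact Fin.ext (h1.choose_spec.2.2.2.symm.trans h.2.2.2)
    have hch : IsChoice I.election I.p ch := by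
      intro v c h
      have h1 := (hchf v c).1 h
      have h2 := hplan.appr v h1.1 h1.2.1 h1.2.2.1
      rw [h1.2.2.2, hd.iff] at h2
      exact ⟨h2, by rw [← hd.iff]; exact h1.2.2.1⟩
    have hres := hchf.results hd hie he hplan.appr hsub
    exact ⟨_, _, bribeToP_iff.2 ⟨ch, hch, rfl, rfl⟩,
      (hchf.planCost_eq hpr hd he hplan.appr).1 hcost,
      (hres.isVoterInterval_iff hd hap).2 hplan, (hres.exists_winning_iff hd hN hN').2 hnum⟩

end Solvable

/-! ### The program -/

/-- The approvals, as stored in the memory. -/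
def memAp (N : ℕ) (μ : ℕ → ℕ) (v c : ℕ) : Prop :=
  v < μ 0 ∧ c < μ 1 ∧ μ (5 + (min v N * μ 1 + c)) ≠ 0

/-- The prices, as stored in the memory, with infinity replaced by a number above the budget. -/
def memPr (N : ℕ) (μ : ℕ → ℕ) (v c : ℕ) : ℕ :=
  if v < μ 0 ∧ c < μ 1 then
    if μ (5 + (min (μ 0) N * μ 1 + (min v N * μ 1 + c))) = 0 then μ 4 + 1
    else μ (5 + (min (μ 0) N * μ 1 + (min v N * μ 1 + c))) - 1
  else 0

/-- The address of a table entry. -/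
def cell (N y q : ℕ) : ℕ := N + 1 + (min y N * N + q)

/-- The memory holds the code of an instance with the voter interval property. -/
def IsValid (N : ℕ) (μ : ℕ → ℕ) : Prop :=
  μ 0 < N ∧ N = 5 + (min (μ 0) N * μ 1 + min (μ 0) N * μ 1) ∧ 1 ≤ μ 2 ∧ μ 2 ≤ μ 1 ∧ μ 3 < μ 1 ∧
    (∀ i < N, i < min (μ 0) N * μ 1 → μ (5 + i) ≤ 1) ∧
    ∀ c < N, ∀ u < N, ∀ v < N, ∀ w < N, u < v → v < w → memAp N μ u c → memAp N μ w c → memAp N μ v c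

/-- Compute one table entry. -/
noncomputable def fillEntry (N : ℕ) (μ : ℕ → ℕ) (i e y q : ℕ) : ℕ → ℕ :=
  Function.update μ (cell N y q) (tableStep N (μ 3) (μ 4) (memAp N μ) (memPr N μ) i (e - i)
    (fun x r => μ (cell N x r)) y q)

/-- Compute one row of the table. -/
noncomputable def fillRow (N : ℕ) (μ : ℕ → ℕ) (i e y : ℕ) (M : ℕ) : ℕ → ℕ :=
  Nat.rec μ (fun q μ' => fillEntry N μ' i e y q) M

/-- Compute the table. -/
noncomputable def fillTable (N : ℕ) (μ : ℕ → ℕ) (i e : ℕ) (M : ℕ) : ℕ → ℕ :=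
  Nat.rec μ (fun y μ' => fillRow N μ' i e y N) M

/-- The test whether `p` can win with the approving voters `i, …, e - 1`. -/
def Accepts (N : ℕ) (μ : ℕ → ℕ) (i e : ℕ) : Prop :=
  i ≤ e ∧ e ≤ μ 0 ∧ (∀ v < N, memAp N μ v (μ 3) → i ≤ v ∧ v < e) ∧
    ∃ q < N, μ (cell N e q) ≤ μ 4 ∧ numAbove N (memAp N μ) (e - i) < q + μ 2

open scoped Classical in
/-- Compute the table for the target interval `i, …, e - 1` and set the flag if the test
succeeds. -/
noncomputable def tryInterval (N : ℕ) (μ : ℕ → ℕ) (i e : ℕ) : ℕ → ℕ :=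
  if Accepts N (fillTable N μ i e N) i e then Function.update (fillTable N μ i e N) N 1
  else fillTable N μ i e N

/-- Try all intervals that start at `i`. -/
noncomputable def tryStart (N : ℕ) (μ : ℕ → ℕ) (i : ℕ) : ℕ → ℕ :=
  Nat.rec μ (fun e μ' => tryInterval N μ' i e) N

/-- Try all intervals. -/
noncomputable def tryAll (N : ℕ) (μ : ℕ → ℕ) : ℕ → ℕ :=
  Nat.rec μ (fun i μ' => tryStart N μ' i) N

open scoped Classical in
/-- Check the input and try all intervals. -/
noncomputable def decide (N : ℕ) (μ : ℕ → ℕ) (_ : Unit) : ℕ → ℕ :=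
  if IsValid N μ then tryAll N μ else μ

/-! ### The program runs in polynomial time -/

section Poly

variable {α : Type} [Env α] {v c p i s x y q e : ℕ → (ℕ → ℕ) → α → ℕ}

theorem Comp.mem (k : ℕ) : Comp (fun _ μ (_ : α) => μ k) := (Comp.const k).load

theorem CompP.memAp (hv : Comp v) (hc : Comp c) :
    CompP (fun N μ a => memAp N μ (v N μ a) (c N μ a)) :=
  (CompP.lt hv (.mem 0)).and ((CompP.lt hc (.mem 1)).and
    (CompP.eq ((Comp.const 5).add ((hv.mul (.mem 1)).add hc)).load (.const 0)).not)

theorem Comp.memPr (hv : Comp v) (hc : Comp c) :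
    Comp (fun N μ a => memPr N μ (v N μ a) (c N μ a)) := by
  have h := ((Comp.const 5).add
    (((Comp.mem 0).mul (.mem 1)).add ((hv.mul (.mem 1)).add hc))).load
  exact .ite ((CompP.lt hv (.mem 0)).and (CompP.lt hc (.mem 1)))
    (.ite (CompP.eq h (.const 0)) ((Comp.mem 4).add (.const 1)) (h.sub (.const 1))) (.const 0)

theorem Comp.cell (hy : Comp y) (hq : Comp q) : Comp (fun N μ a => cell N (y N μ a) (q N μ a)) :=
  (Comp.length.add (.const 1)).add ((hy.mul .length).add hq)

theorem Comp.apScore (hc : Comp c) :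
    Comp (fun N μ a => apScore N (ApprovalBribery.memAp N μ) (c N μ a)) :=
  .sum (.ite (.memAp .snd hc.fst) (.const 1) (.const 0))

theorem CompP.isSegment (hp : Comp p) (hi : Comp i) (hx : Comp x) (hy : Comp y) (hc : Comp c) :
    CompP (fun N μ a => IsSegment N (p N μ a) (ApprovalBribery.memAp N μ) (i N μ a) (x N μ a)
      (y N μ a) (c N μ a)) :=
  (CompP.le hi hx).and <| (CompP.lt hx hy).and <|
    (CompP.ball ((CompP.le hx.fst .snd).imp ((CompP.lt .snd hy.fst).imp
      ((CompP.memAp .snd hc.fst).and (CompP.memAp .snd hp.fst).not)))).and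
    (((CompP.eq hx (.const 0)).or (CompP.memAp (hx.sub (.const 1)) hc).not).or
      (CompP.memAp hy hc).not)

theorem Comp.segCost (hx : Comp x) (hy : Comp y) (hc : Comp c) :
    Comp (fun N μ a => segCost N (ApprovalBribery.memPr N μ) (x N μ a) (y N μ a) (c N μ a)) :=
  .sum (.ite ((CompP.le hx.fst .snd).and (CompP.lt .snd hy.fst)) (.memPr .snd hc.fst) (.const 0))

theorem Comp.gain (hs : Comp s) (hx : Comp x) (hy : Comp y) (hc : Comp c) :
    Comp (fun N μ a => gain N (ApprovalBribery.memAp N μ) (s N μ a) (x N μ a) (y N μ a)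
      (c N μ a)) :=
  .ite ((CompP.lt hs (.apScore hc)).and (CompP.le (.apScore hc) (hs.add (hy.sub hx))))
    (.const 1) (.const 0)

theorem Comp.tableStep (hi : Comp i) (hs : Comp s) (hy : Comp y) (hq : Comp q) :
    Comp (fun N μ a => tableStep N (μ 3) (μ 4) (ApprovalBribery.memAp N μ)
      (ApprovalBribery.memPr N μ) (i N μ a) (s N μ a)
      (fun x r => μ (ApprovalBribery.cell N x r)) (y N μ a) (q N μ a)) := by
  have hg : Comp (fun N μ (b : (α × ℕ) × ℕ) => ApprovalBribery.gain N
      (ApprovalBribery.memAp N μ) (s N μ b.1.1) b.1.2 (y N μ b.1.1) b.2) :=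
    .gain hs.fst.fst Comp.snd.fst hy.fst.fst .snd
  refine .minBelow (.ite ((CompP.eq hy hi).and (CompP.eq hq (.const 0))) (.const 0)
    (.ite ((CompP.lt hi hy).and (.memAp (hy.sub (.const 1)) (.mem 3)))
      (Comp.cell (hy.sub (.const 1)) hq).load ((Comp.mem 4).add (.const 1))))
    (.minBelow ((Comp.mem 4).add (.const 1)) (.ite (.and ?_ ?_) (.add ?_ ?_)
      ((Comp.mem 4).add (.const 1))))
  · exact .isSegment (.mem 3) hi.fst.fst Comp.snd.fst hy.fst.fst .snd
  · exact .le hg hq.fst.fst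
  · exact (Comp.cell Comp.snd.fst (hq.fst.fst.sub hg)).load
  · exact .segCost Comp.snd.fst hy.fst.fst .snd

theorem Comp.numAbove (hs : Comp s) :
    Comp (fun N μ a => numAbove N (ApprovalBribery.memAp N μ) (s N μ a)) :=
  .sum (.ite (.lt hs.fst (.apScore .snd)) (.const 1) (.const 0))

theorem CompP.isValid : CompP (fun N μ (_ : α) => IsValid N μ) := by
  have hnm : Comp (fun N μ (_ : α) => min (μ 0) N * μ 1) := (Comp.mem 0).mul (.mem 1)
  refine (CompP.lt (.mem 0) .length).and <| (CompP.eq .length ((Comp.const 5).add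
    (hnm.add hnm))).and <| (CompP.le (.const 1) (.mem 2)).and <| (CompP.le (.mem 2) (.mem 1)).and <|
    (CompP.lt (.mem 3) (.mem 1)).and <| (CompP.ball ?_).and
      (CompP.ball (CompP.ball (CompP.ball (CompP.ball ?_))))
  · exact (CompP.lt .snd hnm.fst).imp (CompP.le ((Comp.const 5).add .snd).load (.const 1))
  · have hc := (Comp.snd (α := α)).fst.fst.fst
    have hu := (Comp.snd (α := α × ℕ)).fst.fst
    have hv := (Comp.snd (α := (α × ℕ) × ℕ)).fst
    exact (CompP.lt hu hv).imp ((CompP.lt hv .snd).imp ((CompP.memAp hu hc).imp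
      ((CompP.memAp .snd hc).imp (CompP.memAp hv hc))))

theorem CompP.accepts (hi : Comp i) (he : Comp e) :
    CompP (fun N μ a => Accepts N μ (i N μ a) (e N μ a)) :=
  (CompP.le hi he).and <| (CompP.le he (.mem 0)).and <|
    (CompP.ball ((CompP.memAp .snd (.mem 3)).imp
      ((CompP.le hi.fst .snd).and (CompP.lt .snd he.fst)))).and <|
    CompP.bex ((CompP.le (Comp.cell he.fst .snd).load (.mem 4)).and
      (CompP.lt (.numAbove (he.fst.sub hi.fst)) (Comp.snd.add (.mem 2))))

theorem compC_decide : CompC decide := by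
  refine .ite .isValid (.loop (.loop ?_)) .skip
  have hfill : CompC (fun N μ (a : (Unit × ℕ) × ℕ) => fillTable N μ a.1.2 a.2 N) := by
    refine .loop (.loop (.store (.cell Comp.snd.fst .snd) (.tableStep Comp.snd.fst.fst.fst
      (Comp.sub Comp.snd.fst.fst Comp.snd.fst.fst.fst) Comp.snd.fst .snd)))
  -- The test and the setting of the flag are a transformation of the memory that already contains
  -- the table.
  exact hfill.seq (G := fun N μ (a : (Unit × ℕ) × ℕ) =>
      open scoped Classical in if Accepts N μ a.1.2 a.2 then Function.update μ N 1 else μ)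
    (.ite (.accepts Comp.snd.fst .snd) (.store .length (.const 1)) .skip)

end Poly

/-! ### The program is correct -/

section Correct

variable {N : ℕ} {μ μ' : ℕ → ℕ}

theorem mul_add_lt_mul {v n c m : ℕ} (hv : v < n) (hc : c < m) : v * m + c < n * m := by
  have : (v + 1) * m ≤ n * m := Nat.mul_le_mul_right _ hv
  rw [add_mul] at this
  omega

/-- A memory with the same input. -/
def SameInput (N : ℕ) (μ μ' : ℕ → ℕ) : Prop := ∀ a < N, μ' a = μ a

theorem SameInput.memAp (h : SameInput N μ μ') (hμ : IsValid N μ) : memAp N μ' = memAp N μ := by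
  obtain ⟨h1, h2, -⟩ := hμ
  funext v c
  rw [min_eq_left h1.le] at h2
  unfold ApprovalBribery.memAp
  rw [h 0 (by omega), h 1 (by omega), eq_iff_iff]
  refine and_congr_right fun hv => and_congr_right fun hc => ?_
  rw [min_eq_left (by omega)]
  have := mul_add_lt_mul hv hc
  rw [h _ (by omega)]

theorem SameInput.memPr (h : SameInput N μ μ') (hμ : IsValid N μ) : memPr N μ' = memPr N μ := by
  obtain ⟨h1, h2, -⟩ := hμ
  funext v c
  unfold ApprovalBribery.memPr
  rw [h 0 (by omega), h 1 (by omega), h 4 (by omega)]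
  split_ifs with hvc <;> try rfl
  all_goals
    rw [min_eq_left h1.le] at h2
    rw [min_eq_left h1.le, min_eq_left (show v ≤ N by omega)] at *
    have := mul_add_lt_mul hvc.1 hvc.2
    have := h (5 + (μ 0 * μ 1 + (v * μ 1 + c))) (by omega)
    omega

theorem IsValid.lt_of_memAp (hμ : IsValid N μ) {v c : ℕ} (h : memAp N μ v c) :
    v < N ∧ c + 1 < N := by
  obtain ⟨h1, h2, -⟩ := hμ
  have h3 := h.1
  have := Nat.le_mul_of_pos_left (μ 1) (by omega : 0 < μ 0)
  have := h.2.1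
  rw [min_eq_left h1.le] at h2
  omega

theorem IsValid.intervalApprovals (hμ : IsValid N μ) : IntervalApprovals (memAp N μ) := by
  intro c u v w huv hvw hu hw
  have h1 := hμ.lt_of_memAp hu
  have h2 := hμ.lt_of_memAp hw
  exact hμ.2.2.2.2.2.2 c (by omega) u h1.1 v (by omega) w h2.1 huv hvw hu hw

variable {i e y : ℕ}

theorem cell_eq (hy : y < N) (q : ℕ) : cell N y q = N + 1 + (y * N + q) := by
  rw [cell, min_eq_left hy.le]

/-- Row `y` is written from address `N + 1 + y * N` on, so the input, the flag at address `N` and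
the earlier rows survive. -/
theorem fillRow_apply_of_lt (hy : y < N) (M : ℕ) {a : ℕ} (ha : a < N + 1 + y * N) :
    fillRow N μ i e y M a = μ a := by
  induction M with
  | zero => rfl
  | succ M ih =>
    rw [← ih]
    exact Function.update_of_ne (by rw [cell_eq hy]; omega) _ _

theorem fillTable_apply_of_le {M : ℕ} (hM : M ≤ N) {a : ℕ} (ha : a ≤ N) :
    fillTable N μ i e M a = μ a := by
  induction M with
  | zero => rfl
  | succ M ih =>
    rw [← ih (by omega)]
    exact fillRow_apply_of_lt (by omega) N (by omega)

/-- The row `y` of the table in the memory `μ'` is correct for the input in `μ` up to entry `M`. -/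
def RowCorrect (N : ℕ) (μ μ' : ℕ → ℕ) (i e y M : ℕ) : Prop :=
  ∀ q < M, IsOptimum N (μ 3) (μ 4) (memAp N μ) (memPr N μ) i (e - i) y q (μ' (cell N y q))

theorem RowCorrect.congr {M : ℕ} {μ'' : ℕ → ℕ} (h : RowCorrect N μ μ' i e y M)
    (h' : ∀ q < M, μ'' (cell N y q) = μ' (cell N y q)) : RowCorrect N μ μ'' i e y M :=
  fun q hq => by
    rw [h' q hq]
    exact h q hq

/-- Entries left over from previously tried intervals do no harm: row `y` is computed from rows `x`
with `i ≤ x < y` only, which have just been recomputed. -/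
theorem rowCorrect_fillRow (hμ : IsValid N μ) (h : SameInput N μ μ') (hy : y < N) (hiy : i ≤ y)
    (hye : y ≤ e) (hrows : ∀ x, i ≤ x → x < y → RowCorrect N μ μ' i e x N) {M : ℕ} (hM : M ≤ N) :
    RowCorrect N μ (fillRow N μ' i e y M) i e y M := by
  induction M with
  | zero => exact fun q hq => absurd hq (by omega)
  | succ M ih =>
    set ν := fillRow N μ' i e y M with hν
    have hsame : SameInput N μ ν := fun a ha =>
      (fillRow_apply_of_lt hy M (by omega)).trans (h a ha)
    have h5 : 5 ≤ N := by
      have := hμ.2.1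
      omega
    have heq : fillRow N μ' i e y (M + 1) = fillEntry N ν i e y M := rfl
    rw [heq]
    intro q hq
    rcases Nat.lt_succ_iff_lt_or_eq.1 hq with hq | rfl
    · rw [fillEntry, Function.update_of_ne (by rw [cell_eq hy, cell_eq hy]; omega)]
      exact ih (by omega) q hq
    · rw [fillEntry, Function.update_self, hsame.memAp hμ, hsame.memPr hμ, hsame 3 (by omega),
        hsame 4 (by omega)]
      refine isOptimum_tableStep (fun v c hvc => ?_) hμ.intervalApprovals hy.le hiy (by omega)
        fun x r hix hxy hr => ?_
      · have := hμ.lt_of_memAp hvc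
        omega
      · refine (hrows x hix hxy).congr (fun r hr => ?_) r (by omega)
        refine fillRow_apply_of_lt hy _ ?_
        rw [cell_eq (by omega)]
        have := mul_add_lt_mul hxy hr
        omega

theorem rowCorrect_fillTable (hμ : IsValid N μ) (h : SameInput N μ μ') {M : ℕ} (hM : M ≤ N)
    (hiy : i ≤ y) (hye : y ≤ e) (hyM : y < M) :
    RowCorrect N μ (fillTable N μ' i e M) i e y N := by
  induction M generalizing y with
  | zero => omega
  | succ M ih =>
    set ν := fillTable N μ' i e M with hν
    have hsame : SameInput N μ ν := fun a ha =>
      (fillTable_apply_of_le (by omega) ha.le).trans (h a ha)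
    have heq : fillTable N μ' i e (M + 1) = fillRow N ν i e M N := rfl
    rw [heq]
    rcases Nat.lt_succ_iff_lt_or_eq.1 hyM with hyM | rfl
    · refine (ih (by omega) hiy hye hyM).congr fun q hq => fillRow_apply_of_lt (by omega) _ ?_
      rw [cell_eq (by omega)]
      have := mul_add_lt_mul hyM hq
      omega
    · exact rowCorrect_fillRow hμ hsame (by omega) hiy hye
        (fun x hix hxy => ih (by omega) hix (by omega) hxy) le_rfl

/-- There is a suitable plan that makes `i, …, e - 1` the voters who approve the preferred
candidate. -/
def HasPlan (N : ℕ) (μ : ℕ → ℕ) (i e : ℕ) : Prop :=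
  i ≤ e ∧ e ≤ μ 0 ∧ (∀ v, memAp N μ v (μ 3) → i ≤ v ∧ v < e) ∧
    ∃ f, IsPlan (μ 3) (memAp N μ) f i e ∧ planCost (μ 3) (memAp N μ) (memPr N μ) f i e ≤ μ 4 ∧
      numAboveAfter N (μ 3) (memAp N μ) (e - i) f i e < μ 2

theorem accepts_fillTable_iff (hμ : IsValid N μ) (h : SameInput N μ μ') :
    Accepts N (fillTable N μ' i e N) i e ↔ HasPlan N μ i e := by
  have h5 : 5 ≤ N := by
    have := hμ.2.1
    omega
  have hsame : SameInput N μ (fillTable N μ' i e N) := fun a ha =>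
    (fillTable_apply_of_le le_rfl ha.le).trans (h a ha)
  rw [Accepts, HasPlan, hsame.memAp hμ, hsame 0 (by omega), hsame 2 (by omega), hsame 3 (by omega),
    hsame 4 (by omega)]
  refine and_congr_right fun hie => and_congr_right fun he => and_congr ?_ ?_
  · exact ⟨fun H v hv => H v (hμ.lt_of_memAp hv).1 hv, fun H v _ => H v⟩
  · exact exists_isOptimum_iff (fun v c => hμ.lt_of_memAp) (by omega)
      (rowCorrect_fillTable hμ h le_rfl hie le_rfl (he.trans_lt hμ.1))

theorem sameInput_tryInterval (h : SameInput N μ μ') : SameInput N μ (tryInterval N μ' i e) := by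
  intro a ha
  have := (fillTable_apply_of_le (μ := μ') (i := i) (e := e) le_rfl ha.le).trans (h a ha)
  unfold tryInterval
  split_ifs
  · rw [Function.update_of_ne ha.ne, this]
  · exact this

theorem tryInterval_flag (hμ : IsValid N μ) (h : SameInput N μ μ') :
    tryInterval N μ' i e N ≠ 0 ↔ μ' N ≠ 0 ∨ HasPlan N μ i e := by
  unfold tryInterval
  rw [← accepts_fillTable_iff hμ h]
  split_ifs with h1
  · simp [h1]
  · simp [h1, fillTable_apply_of_le (μ := μ') (i := i) (e := e) le_rfl (le_refl N)]

/-- A loop that sets the flag if one of its iterations does. -/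
theorem flag_loop {Q : ℕ → Prop} {F : ℕ → (ℕ → ℕ) → ℕ → ℕ}
    (hF : ∀ i μ', SameInput N μ μ' → SameInput N μ (F i μ') ∧ (F i μ' N ≠ 0 ↔ μ' N ≠ 0 ∨ Q i))
    (h : SameInput N μ μ') (M : ℕ) :
    SameInput N μ (Nat.rec μ' F M) ∧
      ((Nat.rec μ' F M : ℕ → ℕ) N ≠ 0 ↔ μ' N ≠ 0 ∨ ∃ i < M, Q i) := by
  induction M with
  | zero => exact ⟨h, by simp⟩
  | succ M ih =>
    obtain ⟨h1, h2⟩ := hF M _ ih.1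
    refine ⟨h1, h2.trans ?_⟩
    rw [ih.2, or_assoc]
    simp only [Nat.lt_succ_iff_lt_or_eq, or_and_right, exists_or, exists_eq_left]

theorem tryAll_flag (hμ : IsValid N μ) :
    tryAll N μ N ≠ 0 ↔ μ N ≠ 0 ∨ ∃ i < N, ∃ e < N, HasPlan N μ i e := by
  refine (flag_loop (μ := μ) (Q := fun i => ∃ e < N, HasPlan N μ i e)
    (F := fun i μ' => tryStart N μ' i) (fun i μ' h => ?_) (fun _ _ => rfl) N).2
  exact flag_loop (μ := μ) (Q := fun e => HasPlan N μ i e)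
    (F := fun e μ' => tryInterval N μ' i e)
    (fun e μ' h => ⟨sameInput_tryInterval h, tryInterval_flag hμ h⟩) h N

end Correct

/-! ### Codes of instances -/

section Encode

/-- The memory that holds a given input. -/
def inputMem (x : List ℕ) (i : ℕ) : ℕ := x.getD i 0

variable (I : BriberyInstance)

theorem length_encode : I.encode.length = 5 + (I.n * I.m + I.n * I.m) := by
  simp [BriberyInstance.encode]
  omega

theorem divNat_modNat_eq {n m : ℕ} {j : Fin (n * m)} {v : Fin n} {c : Fin m}
    (hj : (j : ℕ) = v * m + c) : j.divNat = v ∧ j.modNat = c := by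
  refine ⟨Fin.ext ?_, Fin.ext ?_⟩
  · simp only [Fin.divNat, hj]
    rw [mul_comm, Nat.mul_add_div c.pos, Nat.div_eq_of_lt c.2, add_zero]
  · simp only [Fin.modNat, hj]
    rw [add_comm, Nat.add_mul_mod_self_right, Nat.mod_eq_of_lt c.2]

theorem inputMem_encode_approval (v : Fin I.n) (c : Fin I.m) :
    inputMem I.encode (5 + (v * I.m + c)) = if c ∈ I.election v then 1 else 0 := by
  have h := mul_add_lt_mul v.2 c.2
  have key : ∀ j : Fin (I.n * I.m), (j : ℕ) = v * I.m + c →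
      (if j.modNat ∈ I.election j.divNat then 1 else 0) = if c ∈ I.election v then 1 else 0 := by
    intro j hj
    rw [(divNat_modNat_eq hj).1, (divNat_modNat_eq hj).2]
  rw [inputMem, BriberyInstance.encode, List.getD_append _ _ _ _ (by simp; omega),
    List.getD_append_right _ _ _ _ (by simp), List.getD_eq_getElem _ _ (by simp; omega),
    List.getElem_ofFn]
  exact key _ (by simp)

theorem inputMem_encode_price (v : Fin I.n) (c : Fin I.m) :
    inputMem I.encode (5 + (I.n * I.m + (v * I.m + c))) = encodePrice (I.price v c) := by
  have h := mul_add_lt_mul v.2 c.2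
  have key : ∀ j : Fin (I.n * I.m), (j : ℕ) = v * I.m + c →
      encodePrice (I.price j.divNat j.modNat) = encodePrice (I.price v c) := by
    intro j hj
    rw [(divNat_modNat_eq hj).1, (divNat_modNat_eq hj).2]
  rw [inputMem, BriberyInstance.encode, List.getD_append_right _ _ _ _ (by simp; omega),
    List.getD_eq_getElem _ _ (by simp; omega), List.getElem_ofFn]
  exact key _ (by simp; omega)

theorem n_lt_length_encode : I.n < I.encode.length := by
  have := Nat.le_mul_of_pos_right I.n (by have := I.one_le_k; have := I.k_le_m; omega : 0 < I.m)
  rw [length_encode]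
  omega

theorem describes_encode : Describes I (memAp I.encode.length (inputMem I.encode)) := by
  intro v c
  have hn := n_lt_length_encode I
  unfold memAp
  rw [show inputMem I.encode 0 = I.n from rfl, show inputMem I.encode 1 = I.m from rfl]
  constructor
  · rintro ⟨hv, hc, h⟩
    refine ⟨hv, hc, ?_⟩
    rw [min_eq_left (by omega)] at h
    have := inputMem_encode_approval I ⟨v, hv⟩ ⟨c, hc⟩
    by_contra h'
    rw [if_neg h'] at this
    exact h this
  · rintro ⟨hv, hc, h⟩
    refine ⟨hv, hc, ?_⟩
    rw [min_eq_left (by omega)]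
    have := inputMem_encode_approval I ⟨v, hv⟩ ⟨c, hc⟩
    rw [if_pos h] at this
    simp only at this
    omega

theorem memPr_encode (v : Fin I.n) (c : Fin I.m) :
    memPr I.encode.length (inputMem I.encode) v c = cappedPrice I.B (I.price v c) := by
  have hn := n_lt_length_encode I
  have hv := v.2
  unfold memPr
  rw [show inputMem I.encode 0 = I.n from rfl, show inputMem I.encode 1 = I.m from rfl,
    show inputMem I.encode 4 = I.B from rfl, min_eq_left (by omega), min_eq_left (by omega),
    inputMem_encode_price, if_pos ⟨v.2, c.2⟩]
  rfl

theorem isValid_encode_iff :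
    IsValid I.encode.length (inputMem I.encode) ↔ I.election.IsVoterInterval := by
  have hn := n_lt_length_encode I
  rw [(describes_encode I).intervalApprovals]
  refine ⟨fun h => h.intervalApprovals, fun h => ?_⟩
  unfold IsValid
  rw [show inputMem I.encode 0 = I.n from rfl, show inputMem I.encode 1 = I.m from rfl,
    show inputMem I.encode 2 = I.k from rfl, show inputMem I.encode 3 = I.p from rfl,
    min_eq_left hn.le]
  refine ⟨hn, length_encode I, I.one_le_k, I.k_le_m, I.p.2, fun i _ hi => ?_,
    fun c _ u _ v _ w _ => h c u v w⟩
  have hm : 0 < I.m := I.p.pos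
  have := inputMem_encode_approval I ⟨i / I.m, Nat.div_lt_of_lt_mul (by rwa [mul_comm])⟩
    ⟨i % I.m, Nat.mod_lt _ hm⟩
  simp only [Nat.div_add_mod'] at this
  rw [this]
  split_ifs <;> omega

theorem exists_plan_iff_solvable (hI : I.election.IsVoterInterval) :
    (∃ i < I.encode.length, ∃ e < I.encode.length,
      HasPlan I.encode.length (inputMem I.encode) i e) ↔ I.Solvable := by
  have hn := n_lt_length_encode I
  have hd := describes_encode I
  have hvalid := (isValid_encode_iff I).2 hI
  rw [solvable_iff hd (hd.intervalApprovals.1 hI) hn.le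
    (fun v c hvc => (Nat.lt_succ_self c).trans (hvalid.lt_of_memAp hvc).2) (memPr_encode I)]
  constructor
  · rintro ⟨i, -, e, -, h⟩
    exact ⟨i, e, h⟩
  · rintro ⟨i, e, h⟩
    have h1 := h.1
    have h2 := h.2.1
    exact ⟨i, by omega, e, by omega, h⟩

/-- Every valid input is the code of an instance. -/
theorem IsValid.exists_encode {x : List ℕ} (h : IsValid x.length (inputMem x)) :
    ∃ I : BriberyInstance, I.encode = x := by
  classical
  obtain ⟨h0, hlen, hk, hkm, hp, hbool, -⟩ := h
  rw [min_eq_left h0.le] at hlen hbool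
  let I : BriberyInstance :=
    { n := inputMem x 0
      m := inputMem x 1
      election := fun v => univ.filter fun c => inputMem x (5 + (v * inputMem x 1 + c)) ≠ 0
      price := fun v c =>
        if inputMem x (5 + (inputMem x 0 * inputMem x 1 + (v * inputMem x 1 + c))) = 0 then ⊤
        else ((inputMem x (5 + (inputMem x 0 * inputMem x 1 + (v * inputMem x 1 + c))) - 1 : ℕ) : ℕ∞)
      k := inputMem x 2
      one_le_k := hk
      k_le_m := hkm
      p := ⟨inputMem x 3, hp⟩
      B := inputMem x 4 }
  have hI : I.encode.length = x.length := (length_encode I).trans hlen.symm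
  have hmem : ∀ a < x.length, inputMem I.encode a = inputMem x a := by
    intro a ha
    have hm : 0 < inputMem x 1 := by omega
    rcases Nat.lt_or_ge a 5 with h5 | h5
    · interval_cases a <;> rfl
    obtain ⟨a, rfl⟩ := Nat.exists_eq_add_of_le h5
    rcases Nat.lt_or_ge a (inputMem x 0 * inputMem x 1) with h6 | h6
    · have := inputMem_encode_approval I
        ⟨a / inputMem x 1, Nat.div_lt_of_lt_mul (by rwa [mul_comm])⟩
        ⟨a % inputMem x 1, Nat.mod_lt _ hm⟩
      have h7 := hbool a (by omega) h6
      simp only [I, mem_filter, mem_univ, true_and, Nat.div_add_mod'] at this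
      rw [this]
      split_ifs <;> omega
    · obtain ⟨a, rfl⟩ := Nat.exists_eq_add_of_le h6
      have hdiv : a / inputMem x 1 < inputMem x 0 :=
        Nat.div_lt_of_lt_mul (by rw [mul_comm]; omega)
      have := inputMem_encode_price I ⟨a / inputMem x 1, hdiv⟩
        ⟨a % inputMem x 1, Nat.mod_lt _ hm⟩
      simp only [I, Nat.div_add_mod'] at this
      rw [this]
      split_ifs with h7
      · exact h7.symm
      · show _ - 1 + 1 = _
        omega
  refine ⟨I, List.ext_getElem hI fun a ha ha' => ?_⟩
  have := hmem a ha'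
  rwa [inputMem, inputMem, List.getD_eq_getElem _ _ ha, List.getD_eq_getElem _ _ ha'] at this

end Encode

end ApprovalBribery

open ApprovalBribery in
theorem mainTheorem2 : ApprovalBribery.InP ApprovalBribery.SwapApprovalsToPVIBribery := by
  classical
  refine inP_of_compP compC_decide (p := fun N μ _ => ¬ μ N = 0)
    (CompP.eq Comp.length.load (.const 0)).not fun x => ?_
  -- The flag is the first cell behind the input and hence initially zero; on invalid inputs it
  -- stays zero.
  have hflag : inputMem x x.length = 0 := List.getD_eq_default _ _ le_rfl
  change _ ↔ ApprovalBribery.decide x.length (inputMem x) () x.length ≠ 0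
  unfold ApprovalBribery.decide
  constructor
  · rintro ⟨I, rfl, hI, hsolv⟩
    rw [if_pos ((isValid_encode_iff I).2 hI), tryAll_flag ((isValid_encode_iff I).2 hI)]
    exact .inr ((exists_plan_iff_solvable I hI).2 hsolv)
  · intro h
    split_ifs at h with hvalid
    · obtain ⟨I, rfl⟩ := hvalid.exists_encode
      have hI := (isValid_encode_iff I).1 hvalid
      refine ⟨I, rfl, hI, (exists_plan_iff_solvable I hI).1 ?_⟩
      exact ((tryAll_flag hvalid).1 h).resolve_left (by simp [hflag])
    · exact absurd hflag h
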